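/- Consider the following network with two base stations (BSs) $1,2$, where BS $i$ has $m_i\ge 1$ radio frequency chains. Users arrive according to a Poisson process with rate $\lambda>0$. Each arriving user is, independently, located in the cell of BS $1$ with probability $p_1$ and in the cell of BS $2$ with probability $p_2=1-p_1$, where $p_1\in[0,1]$. A user can associate with the BS of its own cell at data rate $c_2$ and with the other BS at data rate $c_1$, where $c_2>c_1$ and $c_1$ is normalized to $1$. File sizes are independent and exponential with parameter $\mu>0$ (mean $1/\mu$). If $X_i>0$ users are associated with BS $i$, then each of them that has data rate $r$ is served with throughput $\min(m_i,X_i)\,r/X_i$, and it leaves when its file has been transmitted. Under the Load based policy, an arriving user associates with a BS for which $X_i$ is smallest, ties being broken uniformly at random, and it stays with this BS until it leaves. Let $X_{ir}$ be the number of users associated with BS $i$ at rate $c_r$. The matrix $(X_{ir})_{i,r\in\{1,2\}}$ is a continuous time Markov chain, considered on the set of all states that it can reach from the empty state (for $0<p_1<1$ these are all of $\mathbb{Z}_{\ge0}^{2\times 2}$). The system is called stable if this chain is positive recurrent, and unstable if it is null recurrent or transient. Let $c_2=2$. Then, under the Load based policy: (a) the system is unstable if $\lambda\ge \dfrac{2\mu(m_1+m_2)}{1+\min(p_1,p_2)}$;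 (b) if moreover $m_1=m_2=1$, then the system is stable if $\lambda<\mu$. -/

import Mathlib

open MeasureTheory ProbabilityTheory
open scoped ENNReal

noncomputable section

/-! ### Continuous time Markov chains on a countable state space -/

/-- Transition rates of a continuous time Markov chain (CTMC) without absorbing states:
`rate x y` is the rate of the transition from `x` to `y ≠ x`, and the total transition rate out
of every state is positive and finite. -/
structure CTMC (S : Type*) where
  rate : S → S → ℝ≥0∞
  rate_self : ∀ x, rate x x = 0
  exit_ne_zero : ∀ x, ∑' y, rate x y ≠ 0
  exit_ne_top : ∀ x, ∑' y, rate x y ≠ ∞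

namespace CTMC

/-- The total transition rate `ν x` out of the state `x`. -/
def exitRate {S : Type*} (Q : CTMC S) (x : S) : ℝ≥0∞ := ∑' y, Q.rate x y

theorem exitRate_toReal_pos {S : Type*} (Q : CTMC S) (x : S) : 0 < (Q.exitRate x).toReal :=
  ENNReal.toReal_pos (Q.exit_ne_zero x) (Q.exit_ne_top x)

/-- The transition law of the embedded discrete time chain, `y ↦ rate x y / ν x`. -/
def jumpPMF {S : Type*} (Q : CTMC S) (x : S) : PMF S :=
  PMF.normalize (Q.rate x) (Q.exit_ne_zero x) (Q.exit_ne_top x)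

/-- The transition kernel of the embedded discrete time chain. -/
def jumpKernel {S : Type*} [Countable S] [MeasurableSpace S] [MeasurableSingletonClass S]
    (Q : CTMC S) : Kernel S S :=
  Kernel.ofFunOfCountable fun x => (Q.jumpPMF x).toMeasure

instance {S : Type*} [Countable S] [MeasurableSpace S] [MeasurableSingletonClass S]
    (Q : CTMC S) : IsMarkovKernel Q.jumpKernel :=
  ⟨fun x => inferInstanceAs (IsProbabilityMeasure (Q.jumpPMF x).toMeasure)⟩

/-- The law of the holding time in a state `x`: exponential with parameter `ν x`. -/
def holdKernel {S : Type*} [Countable S] [MeasurableSpace S] [MeasurableSingletonClass S]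
    (Q : CTMC S) : Kernel S ℝ :=
  Kernel.ofFunOfCountable fun x => expMeasure (Q.exitRate x).toReal

instance {S : Type*} [Countable S] [MeasurableSpace S] [MeasurableSingletonClass S]
    (Q : CTMC S) : IsMarkovKernel Q.holdKernel :=
  ⟨fun x => isProbabilityMeasure_expMeasure (Q.exitRate_toReal_pos x)⟩

/-- Given the current state, the joint law of the next state and of the time spent there. -/
def stepKernel {S : Type*} [Countable S] [MeasurableSpace S] [MeasurableSingletonClass S]
    (Q : CTMC S) : Kernel S (S × ℝ) :=
  Q.jumpKernel ⊗ₖ Kernel.prodMkLeft S Q.holdKernel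

instance {S : Type*} [Countable S] [MeasurableSpace S] [MeasurableSingletonClass S]
    (Q : CTMC S) : IsMarkovKernel Q.stepKernel := by
  unfold stepKernel; infer_instance

/-- `stepKernel` as a kernel on the history of visited states and holding times: only the
current (that is, last) state of the history matters. -/
def historyKernel {S : Type*} [Countable S] [MeasurableSpace S] [MeasurableSingletonClass S]
    (Q : CTMC S) (n : ℕ) : Kernel (Π _ : Finset.Iic n, S × ℝ) (S × ℝ) :=
  Q.stepKernel.comap (fun h => (h ⟨n, Finset.mem_Iic.2 le_rfl⟩).1)
    (measurable_fst.comp (measurable_pi_apply _))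

instance {S : Type*} [Countable S] [MeasurableSpace S] [MeasurableSingletonClass S]
    (Q : CTMC S) (n : ℕ) : IsMarkovKernel (Q.historyKernel n) := by
  unfold historyKernel; infer_instance

/-- The law of the CTMC started at `x`, by its construction from the embedded chain and the
holding times: a path `ω` visits the states `(ω 0).1, (ω 1).1, …` in this order, and spends
the times `(ω 0).2, (ω 1).2, …` there. -/
def pathLaw {S : Type*} [Countable S] [MeasurableSpace S] [MeasurableSingletonClass S]
    (Q : CTMC S) (x : S) : Measure (ℕ → S × ℝ) :=
  Kernel.trajMeasure (X := fun _ => S × ℝ)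
    ((Measure.dirac x).prod (expMeasure (Q.exitRate x).toReal)) Q.historyKernel

/-- The time of the `n`-th jump of the path `ω` (with `jumpTime ω 0 = 0`). -/
def jumpTime {S : Type*} (ω : ℕ → S × ℝ) (n : ℕ) : ℝ := ∑ k ∈ Finset.range n, (ω k).2

/-- The path `ω` is in the state `y` at time `t`. -/
def IsAt {S : Type*} (ω : ℕ → S × ℝ) (t : ℝ) (y : S) : Prop :=
  ∃ n, jumpTime ω n ≤ t ∧ t < jumpTime ω (n + 1) ∧ (ω n).1 = y

/-- The first time, not before the first jump, at which the path `ω` is in the state `y`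
(`∞` if there is none): the return time to `y` when `ω` starts at `y`. -/
def returnTime {S : Type*} (y : S) (ω : ℕ → S × ℝ) : ℝ≥0∞ :=
  ⨅ (t : ℝ) (_ : jumpTime ω 1 ≤ t ∧ IsAt ω t y), ENNReal.ofReal t

/-- The state `y` is recurrent: started at `y`, the chain almost surely returns to `y`. -/
def RecurrentState {S : Type*} [Countable S] [MeasurableSpace S] [MeasurableSingletonClass S]
    (Q : CTMC S) (y : S) : Prop :=
  ∀ᵐ ω ∂(Q.pathLaw y), returnTime y ω < ∞

/-- The state `y` is recurrent with a finite expected return time. -/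
def PositiveRecurrentState {S : Type*} [Countable S] [MeasurableSpace S]
    [MeasurableSingletonClass S] (Q : CTMC S) (y : S) : Prop :=
  Q.RecurrentState y ∧ ∫⁻ ω, returnTime y ω ∂(Q.pathLaw y) < ∞

/-- The state `y` is recurrent with an infinite expected return time. -/
def NullRecurrentState {S : Type*} [Countable S] [MeasurableSpace S]
    [MeasurableSingletonClass S] (Q : CTMC S) (y : S) : Prop :=
  Q.RecurrentState y ∧ ∫⁻ ω, returnTime y ω ∂(Q.pathLaw y) = ∞

/-- The state `y` is transient: with positive probability there is no return to `y`. -/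
def TransientState {S : Type*} [Countable S] [MeasurableSpace S] [MeasurableSingletonClass S]
    (Q : CTMC S) (y : S) : Prop :=
  ¬ Q.RecurrentState y

/-- The state `y` can be reached from `x` by finitely many transitions of positive rate. -/
def Reachable {S : Type*} (Q : CTMC S) (x y : S) : Prop :=
  Relation.ReflTransGen (fun a b => Q.rate a b ≠ 0) x y

/-- The chain on the set of states that are reachable from `x₀` is positive recurrent. -/
def PositiveRecurrent {S : Type*} [Countable S] [MeasurableSpace S]
    [MeasurableSingletonClass S] (Q : CTMC S) (x₀ : S) : Prop :=
  ∀ y, Q.Reachable x₀ y → Q.PositiveRecurrentState y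

/-- The chain on the set of states that are reachable from `x₀` is null recurrent. -/
def NullRecurrent {S : Type*} [Countable S] [MeasurableSpace S]
    [MeasurableSingletonClass S] (Q : CTMC S) (x₀ : S) : Prop :=
  ∀ y, Q.Reachable x₀ y → Q.NullRecurrentState y

/-- The chain on the set of states that are reachable from `x₀` is transient. -/
def Transient {S : Type*} [Countable S] [MeasurableSpace S]
    [MeasurableSingletonClass S] (Q : CTMC S) (x₀ : S) : Prop :=
  ∀ y, Q.Reachable x₀ y → Q.TransientState y

end CTMC

/-! ### The network with two base stations -/

/-- Parameters of the network with two base stations, numbered `0` and `1`. Base station `i` has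
`m i` radio frequency chains and lies in cell `i`. Users arrive at rate `lam`; an arriving user is
in cell `k` with probability `p k`; file sizes are exponential with parameter `mu`. The rates `c 0`
and `c 1` are those of a link between a user and a base station that are in different cells and
in the same cell, respectively. -/
structure Network where
  m : Fin 2 → ℕ
  lam : ℝ
  mu : ℝ
  p : Fin 2 → ℝ
  c : Fin 2 → ℝ
  one_le_m : ∀ i, 1 ≤ m i
  lam_pos : 0 < lam
  mu_pos : 0 < mu
  p_nonneg : ∀ k, 0 ≤ p k
  p_sum : p 0 + p 1 = 1
  c_pos : 0 < c 0
  c_lt : c 0 < c 1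

/-- A state `s`: `s i r` is the number of users associated with base station `i` at rate `c r`. -/
abbrev NetState : Type := Fin 2 → Fin 2 → ℕ

/-- The number of users associated with base station `i`. -/
def NetState.load (s : NetState) (i : Fin 2) : ℕ := s i 0 + s i 1

/-- The state in which there is just one user, associated with base station `i` at rate `c r`. -/
def NetState.user (i r : Fin 2) : NetState := Pi.single i (Pi.single r 1)

/-- The empty network. -/
def NetState.empty : NetState := 0

/-- An association policy: the law of the base station that an arriving user in cell `k`
associates with, when the network is in state `s`. -/
abbrev AssociationPolicy : Type := NetState → Fin 2 → PMF (Fin 2)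

/-- The base stations with the smallest number of associated users. -/
def NetState.leastLoaded (s : NetState) : Finset (Fin 2) :=
  Finset.univ.filter fun i => ∀ j, s.load i ≤ s.load j

theorem NetState.leastLoaded_nonempty (s : NetState) : s.leastLoaded.Nonempty := by
  obtain ⟨i, -, hi⟩ := Finset.exists_min_image Finset.univ s.load Finset.univ_nonempty
  exact ⟨i, Finset.mem_filter.2 ⟨Finset.mem_univ i, fun j => hi j (Finset.mem_univ j)⟩⟩

/-- The Load based policy: an arriving user associates with a base station with the smallest
number of associated users; ties are broken uniformly at random. -/
def loadPolicy : AssociationPolicy := fun s _ =>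
  PMF.uniformOfFinset s.leastLoaded s.leastLoaded_nonempty

namespace Network

/-- The index of the rate at which a user in cell `k` associates with base station `i`. -/
def rateIndex (k i : Fin 2) : Fin 2 := if i = k then 1 else 0

/-- The throughput of a user associated with base station `i` at rate `c r` in the state `s`. -/
def throughput (N : Network) (s : NetState) (i r : Fin 2) : ℝ :=
  min (N.m i : ℝ) (s.load i) * (N.c r / s.load i)

/-- The rate of arrivals that lead from the state `s` to the state `s'`. -/
def arrivalRate (N : Network) (a : AssociationPolicy) (s s' : NetState) : ℝ≥0∞ :=
  ∑ k, ∑ i, if s' = s + NetState.user i (rateIndex k i)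
    then ENNReal.ofReal (N.lam * N.p k) * a s k i else 0

/-- The rate of departures that lead from the state `s` to the state `s'`. -/
def departureRate (N : Network) (s s' : NetState) : ℝ≥0∞ :=
  ∑ i, ∑ r, if s = s' + NetState.user i r
    then ENNReal.ofReal (N.mu * (s i r * N.throughput s i r)) else 0

end Network

theorem NetState.ne_add_user (s : NetState) (i r : Fin 2) : s ≠ s + NetState.user i r := by
  intro h
  have := congrFun (congrFun h i) r
  simp [NetState.user] at this

/-- The CTMC induced by the association policy `a`. -/
def Network.chain (N : Network) (a : AssociationPolicy) : CTMC NetState where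
  rate s s' := N.arrivalRate a s s' + N.departureRate s s'
  rate_self s := by
    simp [Network.arrivalRate, Network.departureRate, NetState.ne_add_user s]
  exit_ne_zero s h := by
    have h0 := ENNReal.tsum_eq_zero.1 h
    obtain ⟨k, hk⟩ : ∃ k, 0 < N.p k := by
      by_contra hc
      have h1 := N.p_sum
      have h2 := not_lt.1 (not_exists.1 hc 0)
      have h3 := not_lt.1 (not_exists.1 hc 1)
      linarith
    obtain ⟨i, hi⟩ := (a s k).support_nonempty
    have h4 := (add_eq_zero.1 (h0 (s + NetState.user i (Network.rateIndex k i)))).1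
    have h5 := Finset.sum_eq_zero_iff.1 (Finset.sum_eq_zero_iff.1 h4 k (Finset.mem_univ k)) i
      (Finset.mem_univ i)
    rw [if_pos rfl, mul_eq_zero, ENNReal.ofReal_eq_zero] at h5
    rcases h5 with h5 | h5
    · exact absurd h5 (not_le.2 (mul_pos N.lam_pos hk))
    · exact hi h5
  exit_ne_top s := by
    have key : ∀ (t : NetState) (u : ℝ≥0∞), u ≠ ∞ →
        ∑' s' : NetState, (if s' = t then u else 0) ≠ ∞ := by
      intro t u hu
      rwa [tsum_ite_eq]
    rw [ENNReal.tsum_add]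
    refine ENNReal.add_ne_top.2 ⟨?_, ?_⟩
    · unfold Network.arrivalRate
      rw [Summable.tsum_finsetSum fun _ _ => ENNReal.summable]
      refine ENNReal.sum_ne_top.2 fun k _ => ?_
      rw [Summable.tsum_finsetSum fun _ _ => ENNReal.summable]
      refine ENNReal.sum_ne_top.2 fun i _ => ?_
      exact key _ _ (ENNReal.mul_ne_top ENNReal.ofReal_ne_top ((a s k).apply_ne_top i))
    · unfold Network.departureRate
      rw [Summable.tsum_finsetSum fun _ _ => ENNReal.summable]
      refine ENNReal.sum_ne_top.2 fun i _ => ?_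
      rw [Summable.tsum_finsetSum fun _ _ => ENNReal.summable]
      refine ENNReal.sum_ne_top.2 fun r _ => ?_
      refine ne_top_of_le_ne_top (key (s - NetState.user i r)
        (ENNReal.ofReal (N.mu * (s i r * N.throughput s i r))) ENNReal.ofReal_ne_top)
        (ENNReal.tsum_le_tsum fun s' => ?_)
      split_ifs with h1 h2
      · exact le_rfl
      · exact absurd (by rw [h1, add_tsub_cancel_right]) h2
      · exact zero_le
      · exact le_rfl

/-- The network is stable under the policy `a`: its CTMC, on the set of the states that the
network can reach when it starts empty, is positive recurrent. -/
def Network.Stable (N : Network) (a : AssociationPolicy) : Prop :=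
  (N.chain a).PositiveRecurrent NetState.empty

/-- The network is unstable under the policy `a`: its CTMC, on the set of the states that the
network can reach when it starts empty, is null recurrent or transient. -/
def Network.Unstable (N : Network) (a : AssociationPolicy) : Prop :=
  (N.chain a).NullRecurrent NetState.empty ∨ (N.chain a).Transient NetState.empty

end

/-! Both parts are drift arguments. For (b), take the number of users as Lyapunov function. Arrivals
raise it at rate `λ`; as long as somebody is present, some station loses users at rate at least `μ *
c 0 = μ`. The drift is then at most `λ - μ < 0` off the empty state, and Foster's criterion applies.

For (a), weight each user inversely to its rate: 2 for a user served from the other cell, 1 for a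
user served from its own. Each busy chain then removes weight at mean rate exactly `2μ`, so
departures remove at most `2μ(m₁ + m₂)`. The Load based policy ignores the cell of the arriving
user, so arrivals bring weight at rate `λ(1 + p₂)` or `λ(1 + p₁)`, or a mixture of these, hence at
least `λ(1 + min(p₁, p₂))`. At or above the threshold the weighted count is subharmonic, strictly so
at the empty state, and it has bounded jumps. This excludes finite mean return times.

The analysis uses the embedded chain killed at `y`, that is, the operator `T = taboo y`. The
probability of no visit to `y` in `n` jumps is `T^n 1`, and for recurrent `y` the mean return time
is `∑ T^n (1/ν)` at `y`. Foster's criterion (`tsum_iterate_taboo_lt_top`) is a telescoping bound for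
such sums. In the subharmonic case (`tsum_avoidProb_eq_top`), the probability of avoiding `y` for
`N` jumps is at least a constant over `N`, and the harmonic series diverges. `lintegral_avoid`
carries these statements over to the path measure, and `returnProb_eq_one_solidarity` spreads
recurrence from one state to its whole class. -/

noncomputable section

/-! ### Averages over one jump, free and killed at a state -/

namespace CTMC

variable {S : Type*} (Q : CTMC S)

/-- The expectation of `f` after one jump from `x`. -/
def expect (f : S → ℝ≥0∞) (x : S) : ℝ≥0∞ := ∑' z, Q.jumpPMF x z * f z

/-- The expectation of `f` after one jump from `x`, restricted to jumps that avoid `y`. -/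
def taboo (y : S) (f : S → ℝ≥0∞) : S → ℝ≥0∞ := Q.expect (({y}ᶜ : Set S).indicator f)

theorem expect_const (c : ℝ≥0∞) (x : S) : Q.expect (fun _ => c) x = c := by
  rw [expect, ENNReal.tsum_mul_right, PMF.tsum_coe, one_mul]

theorem expect_mono {f g : S → ℝ≥0∞} (h : f ≤ g) : Q.expect f ≤ Q.expect g := fun _ =>
  ENNReal.tsum_le_tsum fun z => mul_le_mul_right (h z) _

theorem expect_add (f g : S → ℝ≥0∞) : Q.expect (f + g) = Q.expect f + Q.expect g := by
  funext x
  simp only [expect, Pi.add_apply, mul_add, ENNReal.tsum_add]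

theorem expect_tsum (f : ℕ → S → ℝ≥0∞) :
    Q.expect (fun z => ∑' n, f n z) = fun x => ∑' n, Q.expect (f n) x := by
  funext x
  simp only [expect, ← ENNReal.tsum_mul_left]
  exact ENNReal.tsum_comm

theorem taboo_mono {f g : S → ℝ≥0∞} (y : S) (h : f ≤ g) : Q.taboo y f ≤ Q.taboo y g :=
  Q.expect_mono (Set.indicator_mono h)

theorem taboo_monotone (y : S) : Monotone (Q.taboo y) := fun _ _ h => Q.taboo_mono y h

theorem taboo_add (y : S) (f g : S → ℝ≥0∞) : Q.taboo y (f + g) = Q.taboo y f + Q.taboo y g := by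
  rw [taboo, Set.indicator_add', expect_add]; rfl

theorem taboo_const_mul (y : S) (c : ℝ≥0∞) (f : S → ℝ≥0∞) :
    Q.taboo y (fun z => c * f z) = fun x => c * Q.taboo y f x := by
  funext x
  simp only [taboo, expect, ← ENNReal.tsum_mul_left]
  refine tsum_congr fun z => ?_
  by_cases hz : z = y
  · simp [hz]
  · simp [hz, mul_left_comm]

theorem taboo_tsum (y : S) (f : ℕ → S → ℝ≥0∞) :
    Q.taboo y (fun z => ∑' n, f n z) = fun x => ∑' n, Q.taboo y (f n) x := by
  refine Eq.trans ?_ (Q.expect_tsum fun n => ({y}ᶜ : Set S).indicator (f n))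
  rw [taboo]
  congr 1
  funext z
  by_cases hz : z = y <;> simp [hz]

theorem taboo_le_expect (y : S) (f : S → ℝ≥0∞) : Q.taboo y f ≤ Q.expect f :=
  Q.expect_mono (Set.indicator_le_self _ _)

theorem expect_eq_taboo_add (y : S) (f : S → ℝ≥0∞) (x : S) :
    Q.expect f x = Q.taboo y f x + f y * Q.jumpPMF x y := by
  have h : f = ({y}ᶜ : Set S).indicator f + ({y} : Set S).indicator f := by
    rw [add_comm, Set.indicator_self_add_compl]
  conv_lhs => rw [h, expect_add]
  rw [Pi.add_apply, taboo]
  congr 1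
  rw [expect, tsum_eq_single y]
  · simp [mul_comm]
  · intro z hz; simp [hz]

theorem iterate_taboo_mono (y : S) (n : ℕ) {f g : S → ℝ≥0∞} (h : f ≤ g) :
    (Q.taboo y)^[n] f ≤ (Q.taboo y)^[n] g :=
  (Q.taboo_monotone y).iterate n h

theorem iterate_taboo_add (y : S) (n : ℕ) (f g : S → ℝ≥0∞) :
    (Q.taboo y)^[n] (f + g) = (Q.taboo y)^[n] f + (Q.taboo y)^[n] g := by
  induction n generalizing f g with
  | zero => rfl
  | succ n ih => simp only [Function.iterate_succ_apply, taboo_add, ih]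

theorem iterate_taboo_const_mul (y : S) (n : ℕ) (c : ℝ≥0∞) (f : S → ℝ≥0∞) :
    (Q.taboo y)^[n] (fun z => c * f z) = fun x => c * (Q.taboo y)^[n] f x := by
  induction n generalizing f with
  | zero => rfl
  | succ n ih => simp only [Function.iterate_succ_apply, taboo_const_mul, ih]

theorem jumpPMF_ne_zero {x z : S} : Q.jumpPMF x z ≠ 0 ↔ Q.rate x z ≠ 0 := by
  rw [← PMF.mem_support_iff]
  exact PMF.mem_support_normalize_iff _ _ _

theorem jumpPMF_apply (x z : S) : Q.jumpPMF x z = Q.rate x z * (Q.exitRate x)⁻¹ := rfl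

theorem exists_rate_ne_zero (x : S) : ∃ z, Q.rate x z ≠ 0 := by
  by_contra! h
  exact Q.exit_ne_zero x (ENNReal.tsum_eq_zero.2 h)

/-- Minimum principle: a strict excess at one successor of positive probability would make the whole
average exceed `c`. Finiteness of `c` is what keeps the strict inequality of sums. -/
theorem eq_of_expect_le {f : S → ℝ≥0∞} {x : S} {c : ℝ≥0∞} (hc : c ≠ ∞)
    (hf : ∀ z, Q.rate x z ≠ 0 → c ≤ f z) (h : Q.expect f x ≤ c) {z : S} (hz : Q.rate x z ≠ 0) :
    f z = c := by
  refine le_antisymm (not_lt.1 fun hlt => ?_) (hf z hz)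
  refine absurd h (not_le.2 ?_)
  rw [← Q.expect_const c x]
  refine ENNReal.tsum_lt_tsum (i := z) ?_ (fun w => ?_) ?_
  · have := Q.expect_const c x
    rw [expect] at this
    rwa [this]
  · by_cases hw : Q.jumpPMF x w = 0
    · simp [hw]
    · exact mul_le_mul_right (hf w (Q.jumpPMF_ne_zero.1 hw)) _
  · exact ENNReal.mul_lt_mul_right (Q.jumpPMF_ne_zero.2 hz) ((Q.jumpPMF x).apply_ne_top z) hlt

theorem eq_of_le_expect {f : S → ℝ≥0∞} {x : S} {c : ℝ≥0∞} (hc : c ≠ ∞)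
    (hf : ∀ z, f z ≤ c) (h : c ≤ Q.expect f x) {z : S} (hz : Q.rate x z ≠ 0) :
    f z = c := by
  refine le_antisymm (hf z) (not_lt.1 fun hlt => ?_)
  refine absurd h (not_le.2 ?_)
  have hx := Q.expect_const c x
  refine lt_of_lt_of_eq ?_ hx
  refine ENNReal.tsum_lt_tsum (i := z) (ne_top_of_le_ne_top hc ?_) (fun w => ?_) ?_
  · rw [← hx]
    exact Q.expect_mono hf x
  · exact mul_le_mul_right (hf w) _
  · exact ENNReal.mul_lt_mul_right (Q.jumpPMF_ne_zero.2 hz) ((Q.jumpPMF x).apply_ne_top z) hlt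

/-! ### Return probabilities -/

/-- The probability that the chain started at `x` does not visit `y` in the jumps `1, …, n`. -/
def avoidProb (y : S) (n : ℕ) : S → ℝ≥0∞ := (Q.taboo y)^[n] 1

theorem avoidProb_zero (y x : S) : Q.avoidProb y 0 x = 1 := rfl

theorem avoidProb_succ (y : S) (n : ℕ) : Q.avoidProb y (n + 1) = Q.taboo y (Q.avoidProb y n) :=
  Function.iterate_succ_apply' _ _ _

/-- The `k`-th summand is the probability that the first visit to `y` occurs at jump `k + 1`.
Algebraically, `1 = p(·, y) + T 1` is iterated. -/
theorem sum_iterate_taboo_add_avoidProb (y : S) (N : ℕ) (x : S) :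
    ∑ k ∈ Finset.range N, (Q.taboo y)^[k] (fun z => Q.jumpPMF z y) x + Q.avoidProb y N x = 1 := by
  induction N with
  | zero => simp [avoidProb_zero]
  | succ N ih =>
    rw [Finset.sum_range_succ, add_assoc, ← ih]
    congr 1
    have h : (1 : S → ℝ≥0∞) = (fun z => Q.jumpPMF z y) + Q.taboo y 1 := by
      funext z
      have := Q.expect_eq_taboo_add y 1 z
      rw [show (1 : S → ℝ≥0∞) = fun _ => 1 from rfl, expect_const, one_mul] at this
      rw [Pi.add_apply, add_comm]
      exact this
    conv_rhs => rw [avoidProb, h, iterate_taboo_add]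
    rfl

theorem avoidProb_le_one (y : S) (n : ℕ) (x : S) : Q.avoidProb y n x ≤ 1 := by
  rw [← Q.sum_iterate_taboo_add_avoidProb y n x]
  exact le_add_self

theorem avoidProb_ne_top (y : S) (n : ℕ) (x : S) : Q.avoidProb y n x ≠ ∞ :=
  ne_top_of_le_ne_top ENNReal.one_ne_top (Q.avoidProb_le_one y n x)

theorem antitone_avoidProb (y : S) (x : S) : Antitone fun n => Q.avoidProb y n x := by
  refine antitone_nat_of_succ_le fun n => ?_
  simp only [avoidProb, Function.iterate_succ_apply]
  exact Q.iterate_taboo_mono y n (fun z => Q.avoidProb_le_one y 1 z) x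

/-- The probability that the chain started at `x` visits `y` after at least one jump. -/
def returnProb (y x : S) : ℝ≥0∞ := ∑' k, (Q.taboo y)^[k] (fun z => Q.jumpPMF z y) x

theorem returnProb_le_one (y x : S) : Q.returnProb y x ≤ 1 := by
  rw [returnProb, ENNReal.tsum_eq_iSup_nat]
  refine iSup_le fun N => ?_
  rw [← Q.sum_iterate_taboo_add_avoidProb y N x]
  exact le_self_add

theorem returnProb_eq_one_iff (y x : S) :
    Q.returnProb y x = 1 ↔ ⨅ n, Q.avoidProb y n x = 0 := by
  have h1 := (ENNReal.tendsto_nat_tsum fun k => (Q.taboo y)^[k] (fun z => Q.jumpPMF z y) x).add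
    (tendsto_atTop_iInf (Q.antitone_avoidProb y x))
  simp only [sum_iterate_taboo_add_avoidProb] at h1
  have h2 : Q.returnProb y x + ⨅ n, Q.avoidProb y n x = 1 :=
    tendsto_nhds_unique h1 tendsto_const_nhds
  constructor
  · intro h
    rw [h] at h2
    exact (ENNReal.add_right_inj ENNReal.one_ne_top).1 (h2.trans (add_zero 1).symm)
  · intro h
    rwa [h, add_zero] at h2

theorem returnProb_eq (y x : S) :
    Q.returnProb y x = Q.taboo y (Q.returnProb y) x + Q.jumpPMF x y := by
  conv_lhs => rw [returnProb, tsum_eq_zero_add' ENNReal.summable]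
  rw [add_comm]
  congr 1
  rw [show Q.returnProb y = fun z => ∑' k, (Q.taboo y)^[k] (fun z => Q.jumpPMF z y) z from rfl,
    taboo_tsum]
  simp only [Function.iterate_succ_apply']

/-- Relative to a state that is visited with probability one, superharmonic functions are bounded
below. -/
theorem mul_returnProb_le {g : S → ℝ≥0∞} (hg : ∀ x, Q.expect g x ≤ g x) (y x : S) :
    g y * Q.returnProb y x ≤ g x := by
  rw [returnProb, ← ENNReal.tsum_mul_left, ENNReal.tsum_eq_iSup_nat]
  refine iSup_le fun N => ?_
  -- The remainder `T^N g` is kept so that the induction closes: superharmonicity reads `g y * p(·,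
  -- y) + T g ≤ g`.
  refine le_trans le_self_add (b := _ + (Q.taboo y)^[N] g x) ?_
  induction N with
  | zero => simp
  | succ N ih =>
    refine le_trans ?_ ih
    rw [Finset.sum_range_succ, add_assoc]
    gcongr
    have h : (fun z => g y * Q.jumpPMF z y) + Q.taboo y g ≤ g := fun z => by
      rw [Pi.add_apply, add_comm, ← expect_eq_taboo_add]
      exact hg z
    have h' := Q.iterate_taboo_mono y N h x
    rw [iterate_taboo_add, iterate_taboo_const_mul] at h'
    exact h'

/-- As its value at `y` is 1, the return probability averages over one jump to itself, and it is at
most 1. The maximum 1 therefore propagates to successors. -/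
theorem returnProb_eq_one_of_reachable {y x : S} (hy : Q.returnProb y y = 1)
    (h : Q.Reachable y x) : Q.returnProb y x = 1 := by
  induction h with
  | refl => exact hy
  | @tail b c _ hbc ih =>
    by_cases hc : c = y
    · rwa [hc]
    have h1 : 1 ≤ Q.expect (fun z => Q.returnProb y z) b := by
      rw [← ih, expect_eq_taboo_add, hy, one_mul]
      exact (Q.returnProb_eq y b).le
    exact Q.eq_of_le_expect ENNReal.one_ne_top (Q.returnProb_le_one y) h1 hbc

/-- Let `g` be the probability of hitting `x` at time 0 or later; it is superharmonic. Recurrence of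
`y` gives `g ≥ g y` on everything reachable from `y`, and the minimum principle makes `g` constant
there. The constant is `g x = 1`, and averaging `g` over one jump from `x` gives the return
probability. -/
theorem returnProb_eq_one_solidarity {y x : S} (hy : Q.returnProb y y = 1)
    (hyx : Q.Reachable y x) : Q.returnProb x x = 1 := by
  classical
  let g : S → ℝ≥0∞ := Function.update (Q.returnProb x) x 1
  have hgx : g x = 1 := Function.update_self _ _ _
  have hexp : ∀ z, Q.expect g z = Q.returnProb x z := fun z => by
    rw [Q.expect_eq_taboo_add x, returnProb_eq, hgx, one_mul]
    congr 1
    simp only [taboo]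
    congr 1
    funext w
    by_cases hw : w = x
    · simp [hw]
    · simp [g, hw]
  have hle : ∀ z, Q.returnProb x z ≤ g z := fun z => by
    by_cases hz : z = x
    · rw [hz, hgx]
      exact Q.returnProb_le_one x x
    · simp [g, hz]
  have hg : ∀ z, Q.expect g z ≤ g z := fun z => (hexp z).trans_le (hle z)
  have hlow : ∀ z, Q.Reachable y z → g y ≤ g z := fun z hz => by
    have := Q.mul_returnProb_le hg y z
    rwa [Q.returnProb_eq_one_of_reachable hy hz, mul_one] at this
  have hg1 : g y ≠ ∞ := ne_top_of_le_ne_top ENNReal.one_ne_top (hgx ▸ hlow x hyx)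
  have heq : ∀ z, Q.Reachable y z → g z = g y := fun z hz => by
    induction hz with
    | refl => rfl
    | @tail b c hb hbc ih =>
      exact Q.eq_of_expect_le hg1 (fun w hw => hlow w (hb.tail hw)) (ih ▸ hg b) hbc
  have hy1 : g y = 1 := (heq x hyx).symm.trans hgx
  rw [← hexp]
  rw [← Q.expect_const 1 x]
  refine tsum_congr fun z => ?_
  by_cases hz : Q.jumpPMF x z = 0
  · simp [hz]
  · rw [heq z (hyx.tail (Q.jumpPMF_ne_zero.1 hz)), hy1]

/-! ### Drift criteria -/

/-- Telescoping: `T^n w ≤ T^n W - T^(n+1) W`, written without subtraction. -/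
theorem tsum_iterate_taboo_le {y : S} {W w : S → ℝ≥0∞} (h : ∀ x, Q.taboo y W x + w x ≤ W x)
    (x : S) : ∑' n, (Q.taboo y)^[n] w x ≤ W x := by
  rw [ENNReal.tsum_eq_iSup_nat]
  refine iSup_le fun N => ?_
  refine le_trans le_self_add (b := _ + (Q.taboo y)^[N] W x) ?_
  induction N with
  | zero => simp
  | succ N ih =>
    refine le_trans ?_ ih
    rw [Finset.sum_range_succ, add_assoc]
    gcongr
    have h' := Q.iterate_taboo_mono y N (f := Q.taboo y W + w) (g := W) h x
    rw [iterate_taboo_add, add_comm] at h'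
    exact h'

/-- If avoiding `y` forever were certain from `x`, it would be certain from every successor, hence
along a path that ends in `y`. The first jump is treated apart because `x` may equal `y`. -/
theorem exists_avoidProb_lt_one {x y : S} (h : ∀ z, Q.Reachable x z → Q.Reachable z y) :
    ∃ n, Q.avoidProb y n x < 1 := by
  by_contra! hx
  have step : ∀ b c, (∀ n, 1 ≤ Q.avoidProb y n b) → Q.rate b c ≠ 0 →
      c ≠ y ∧ ∀ n, 1 ≤ Q.avoidProb y n c := by
    intro b c hb hbc
    have key : ∀ n, ({y}ᶜ : Set S).indicator (Q.avoidProb y n) c = 1 := fun n =>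
      Q.eq_of_le_expect ENNReal.one_ne_top
        (fun z => (Set.indicator_le_self _ _ z).trans (Q.avoidProb_le_one y n z))
        ((hb (n + 1)).trans_eq (by rw [avoidProb_succ]; rfl)) hbc
    have hc : c ≠ y := fun hc => by simpa [hc] using key 0
    exact ⟨hc, fun n => by simpa [hc] using (key n).ge⟩
  obtain ⟨z, hz⟩ := Q.exists_rate_ne_zero x
  have hzy := h z (.single hz)
  have key : ∀ t, Q.Reachable z t → t ≠ y ∧ ∀ n, 1 ≤ Q.avoidProb y n t := fun t ht => by
    induction ht with
    | refl => exact step x z hx hz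
    | @tail b c _ hbc ih => exact step b c ih.2 hbc
  exact (key y hzy).1 rfl

/-- A version of Foster's criterion. -/
theorem tsum_iterate_taboo_lt_top {x₀ y : S} {V w : S → ℝ≥0∞} {B : ℝ≥0∞} (hB : B ≠ ∞)
    (hV : ∀ x, V x ≠ ∞) (h₀ : Q.expect V x₀ + w x₀ ≤ V x₀ + B)
    (h : ∀ x, x ≠ x₀ → Q.expect V x + w x ≤ V x)
    (hr : ∀ z, Q.Reachable x₀ z → Q.Reachable z y) (x : S) :
    ∑' n, (Q.taboo y)^[n] w x < ∞ := by
  obtain ⟨m, hm⟩ := Q.exists_avoidProb_lt_one hr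
  -- The drift condition fails by `B` at `x₀`, and a multiple of `φ` repairs it. The discounted sum
  -- satisfies `φ = 1 + T φ / 2`, so `φ - T φ = 2 - φ`. This is nonnegative everywhere and positive
  -- at `x₀`, so `K = B / (2 - φ x₀)` absorbs the defect.
  let φ : S → ℝ≥0∞ := fun z => ∑' n, (2⁻¹ : ℝ≥0∞) ^ n * Q.avoidProb y n z
  have hgeom : ∑' n : ℕ, (2⁻¹ : ℝ≥0∞) ^ n = 2 := by
    rw [ENNReal.tsum_geometric, ENNReal.one_sub_inv_two, inv_inv]
  have hφ2 : ∀ z, φ z ≤ 2 := fun z => by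
    rw [← hgeom]
    exact ENNReal.tsum_le_tsum fun n => mul_le_of_le_one_right' (Q.avoidProb_le_one y n z)
  have hφ0 : φ x₀ < 2 := by
    rw [← hgeom]
    refine ENNReal.tsum_lt_tsum (i := m) (ne_top_of_le_ne_top ENNReal.ofNat_ne_top (hφ2 x₀))
      (fun n => mul_le_of_le_one_right' (Q.avoidProb_le_one y n x₀)) ?_
    conv_rhs => rw [← mul_one ((2⁻¹ : ℝ≥0∞) ^ m)]
    exact ENNReal.mul_lt_mul_right (pow_ne_zero _ (by simp)) (ENNReal.pow_ne_top (by simp)) hm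
  have hφ : ∀ z, φ z = 1 + 2⁻¹ * Q.taboo y φ z := fun z => by
    simp only [φ]
    rw [tsum_eq_zero_add' ENNReal.summable, taboo_tsum, ← ENNReal.tsum_mul_left]
    simp only [taboo_const_mul, avoidProb_succ, avoidProb_zero, pow_zero, mul_one, pow_succ',
      mul_assoc]
  have hφ' : ∀ z, Q.taboo y φ z + 2 = φ z + φ z := fun z => by
    rw [hφ z, ← two_mul, mul_add, ← mul_assoc,
      ENNReal.mul_inv_cancel two_ne_zero ENNReal.ofNat_ne_top, one_mul, mul_one, add_comm]
  have hfin : ∀ z, φ z ≠ ∞ := fun z => ne_top_of_le_ne_top ENNReal.ofNat_ne_top (hφ2 z)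
  have hd : 2 - φ x₀ ≠ 0 := (tsub_pos_of_lt hφ0).ne'
  have hd' : 2 - φ x₀ ≠ ∞ := ne_top_of_le_ne_top ENNReal.ofNat_ne_top tsub_le_self
  let K : ℝ≥0∞ := B / (2 - φ x₀)
  have hK : K ≠ ∞ := ENNReal.div_ne_top hB hd
  have hKB : K * (2 - φ x₀) = B := ENNReal.div_mul_cancel hd hd'
  have htle : ∀ z, Q.taboo y φ z ≤ φ z := fun z => by
    refine (ENNReal.add_le_add_iff_right (a := 2) ENNReal.ofNat_ne_top).1 ?_
    rw [hφ' z]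
    gcongr
    exact hφ2 z
  have htle0 : Q.taboo y φ x₀ + (2 - φ x₀) ≤ φ x₀ := by
    refine (ENNReal.add_le_add_iff_right (a := φ x₀) (hfin x₀)).1 ?_
    rw [add_assoc, tsub_add_cancel_of_le (hφ2 x₀), hφ']
  refine lt_of_le_of_lt (Q.tsum_iterate_taboo_le (W := V + fun z => K * φ z) (fun z => ?_) x)
    (ENNReal.add_lt_top.2 ⟨(hV x).lt_top, ENNReal.mul_lt_top hK.lt_top (hfin x).lt_top⟩)
  rw [taboo_add, taboo_const_mul, Pi.add_apply, Pi.add_apply, add_right_comm]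
  by_cases hz : z = x₀
  · subst hz
    calc Q.taboo y V z + w z + K * Q.taboo y φ z ≤ (V z + B) + K * Q.taboo y φ z := by
          refine add_le_add_left (le_trans ?_ h₀) _
          exact add_le_add_left (Q.taboo_le_expect y V z) _
      _ = V z + K * (Q.taboo y φ z + (2 - φ z)) := by rw [mul_add, hKB]; ring
      _ ≤ V z + K * φ z := by gcongr
  · refine add_le_add (le_trans ?_ (h z hz)) (mul_le_mul_right (htle z) _)
    exact add_le_add_left (Q.taboo_le_expect y V z) _

/-- On the event that `y` is avoided, `n` jumps raise `V` by at most `n * b`. -/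
theorem iterate_taboo_le_of_bounded_jumps {V : S → ℝ≥0∞} {b : ℝ≥0∞}
    (hb : ∀ x z, Q.rate x z ≠ 0 → V z ≤ V x + b) (y : S) (n : ℕ) (x : S) :
    (Q.taboo y)^[n] V x ≤ (V x + n * b) * Q.avoidProb y n x := by
  induction n generalizing x with
  | zero => simp [avoidProb_zero]
  | succ n ih =>
    rw [Function.iterate_succ_apply', avoidProb_succ]
    calc Q.taboo y ((Q.taboo y)^[n] V) x
        ≤ Q.taboo y (fun z => (V x + (n + 1 : ℕ) * b) * Q.avoidProb y n z) x := by
          refine ENNReal.tsum_le_tsum fun z => ?_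
          by_cases hz : Q.jumpPMF x z = 0
          · simp [hz]
          refine mul_le_mul_right ?_ _
          by_cases hzy : z = y
          · simp [hzy]
          · simp only [Set.mem_compl_iff, Set.mem_singleton_iff, hzy, not_false_eq_true,
              Set.indicator_of_mem]
            refine (ih z).trans (mul_le_mul_left ?_ _)
            calc V z + n * b ≤ V x + b + n * b := by
                  gcongr
                  exact hb x z (Q.jumpPMF_ne_zero.1 hz)
              _ = _ := by push_cast; ring
      _ = _ := by rw [taboo_const_mul]

/-- Only the part of the path after its last visit to `y` matters, and the killed chain can follow
it. -/
theorem exists_iterate_taboo_ne_zero {y x : S} (h : Q.Reachable y x) {f : S → ℝ≥0∞}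
    (hf : f x ≠ 0) : ∃ n, (Q.taboo y)^[n] f y ≠ 0 := by
  induction h generalizing f with
  | refl => exact ⟨0, hf⟩
  | @tail b c _ hbc ih =>
    by_cases hc : c = y
    · exact ⟨0, hc ▸ hf⟩
    have hb : Q.taboo y f b ≠ 0 := fun h0 => by
      have := ENNReal.tsum_eq_zero.1 h0 c
      simp [hc, hf, Q.jumpPMF_ne_zero.2 hbc] at this
    obtain ⟨n, hn⟩ := ih hb
    exact ⟨n + 1, hn⟩

/-- Optional stopping at the first return to `y`: the gains `g` before the return are paid for by
the value of `V` when stopped or at jump `N`. -/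
theorem add_sum_iterate_taboo_le {V g : S → ℝ≥0∞} (h : ∀ x, V x + g x ≤ Q.expect V x) (y : S)
    (N : ℕ) (x : S) : V x + ∑ n ∈ Finset.range N, (Q.taboo y)^[n] g x ≤
      (Q.taboo y)^[N] V x +
        V y * ∑ n ∈ Finset.range N, (Q.taboo y)^[n] (fun z => Q.jumpPMF z y) x := by
  induction N with
  | zero => simp
  | succ N ih =>
    have h1 : V + g ≤ Q.taboo y V + fun z => V y * Q.jumpPMF z y := fun z =>
      (h z).trans_eq (Q.expect_eq_taboo_add y V z)
    have h2 := Q.iterate_taboo_mono y N h1 x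
    simp only [iterate_taboo_add, iterate_taboo_const_mul, Pi.add_apply] at h2
    rw [Finset.sum_range_succ, Finset.sum_range_succ, mul_add, ← add_assoc]
    refine (add_le_add_left ih _).trans ?_
    rw [add_right_comm]
    refine (add_le_add_left h2 _).trans_eq ?_
    rw [Function.iterate_succ_apply]
    ring

/-- If a function with bounded jumps is subharmonic, strictly so at some state, then expected
return times are infinite. -/
theorem tsum_avoidProb_eq_top {x₀ y : S} {V : S → ℝ≥0∞} {b : ℝ≥0∞} (hb' : b ≠ ∞)
    (hV : ∀ x, V x ≠ ∞) (hb : ∀ x z, Q.rate x z ≠ 0 → V z ≤ V x + b)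
    (h : ∀ x, V x ≤ Q.expect V x) (h₀ : V x₀ < Q.expect V x₀) (hr : Q.Reachable y x₀) :
    ∑' n, Q.avoidProb y n y = ∞ := by
  obtain ⟨m, hm⟩ := Q.exists_iterate_taboo_ne_zero hr (f := fun x => Q.expect V x - V x)
    (tsub_pos_of_lt h₀).ne'
  set e := (Q.taboo y)^[m] (fun x => Q.expect V x - V x) y with he
  -- Stopping contributes at most `V y`, which cancels the initial value. The gain `e` must thus be
  -- carried by paths that have avoided `y` for `N` jumps, where `V ≤ V y + N * b`. Hence the
  -- avoidance probability decays no faster than a constant over `N`.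
  have hlow : ∀ N, m < N → e ≤ (V y + N * b) * Q.avoidProb y N y := fun N hN => by
    refine le_trans ?_ (Q.iterate_taboo_le_of_bounded_jumps hb y N y)
    have h1 := Q.add_sum_iterate_taboo_le (V := V) (g := fun x => Q.expect V x - V x)
      (fun x => (add_tsub_cancel_of_le (h x)).le) y N y
    have h2 : ∑ n ∈ Finset.range N, (Q.taboo y)^[n] (fun z => Q.jumpPMF z y) y ≤ 1 :=
      (Q.sum_iterate_taboo_add_avoidProb y N y) ▸ le_self_add
    have h3 : V y + e ≤ V y + (Q.taboo y)^[N] V y := by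
      refine le_trans ?_ (h1.trans ?_)
      · gcongr
        exact Finset.single_le_sum
          (f := fun n => (Q.taboo y)^[n] (fun x => Q.expect V x - V x) y)
          (fun _ _ => zero_le) (Finset.mem_range.2 hN)
      · rw [add_comm]
        gcongr
        exact mul_le_of_le_one_right' h2
    exact (ENNReal.add_le_add_iff_left (hV y)).1 h3
  by_contra hsum
  have hs := ENNReal.summable_toReal hsum
  have hC : V y + b ≠ ∞ := ENNReal.add_ne_top.2 ⟨hV y, hb'⟩
  have he_top : e ≠ ∞ := by
    refine ne_top_of_le_ne_top ?_ (hlow (m + 1) (Nat.lt_succ_self m))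
    exact ENNReal.mul_ne_top
      (ENNReal.add_ne_top.2 ⟨hV y, ENNReal.mul_ne_top (ENNReal.natCast_ne_top _) hb'⟩)
      (Q.avoidProb_ne_top _ _ _)
  have hbound : ∀ N, m < N →
      e.toReal * (N : ℝ)⁻¹ ≤ (V y + b).toReal * (Q.avoidProb y N y).toReal := fun N hN => by
    have hN' : (0 : ℝ) < N := by exact_mod_cast (Nat.zero_le m).trans_lt hN
    rw [← div_eq_mul_inv, div_le_iff₀ hN', ← ENNReal.toReal_natCast, ← ENNReal.toReal_mul,
      ← ENNReal.toReal_mul]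
    refine ENNReal.toReal_mono (ENNReal.mul_ne_top
      (ENNReal.mul_ne_top hC (Q.avoidProb_ne_top _ _ _)) (ENNReal.natCast_ne_top _)) ?_
    refine (hlow N hN).trans ?_
    rw [mul_right_comm]
    gcongr
    rw [add_mul, mul_comm b]
    gcongr
    exact le_mul_of_one_le_right' (by exact_mod_cast (Nat.zero_le m).trans_lt hN)
  have hs2 : Summable fun N : ℕ => e.toReal * (N : ℝ)⁻¹ := by
    refine (hs.mul_left (V y + b).toReal).of_norm_bounded_eventually_nat ?_
    filter_upwards [Filter.eventually_gt_atTop m] with N hN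
    rw [Real.norm_of_nonneg (by positivity)]
    exact hbound N hN
  rw [summable_mul_left_iff (ENNReal.toReal_pos hm he_top).ne'] at hs2
  exact Real.not_summable_natCast_inv hs2

end CTMC

/-! ### Exponential laws and the initial law of a trajectory -/

theorem ProbabilityTheory.lintegral_ofReal_expMeasure {r : ℝ} (hr : 0 < r) :
    ∫⁻ t, ENNReal.ofReal t ∂(expMeasure r) = (ENNReal.ofReal r)⁻¹ := by
  have hm : ∀ a, Measurable (gammaPDF a r) := fun a => (measurable_gammaPDFReal a r).ennreal_ofReal
  rw [expMeasure, gammaMeasure, lintegral_withDensity_eq_lintegral_mul₀ (hm 1).aemeasurable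
    ENNReal.measurable_ofReal.aemeasurable]
  -- Multiplying the exponential density by `t` gives `1/r` times the Gamma density of shape 2,
  -- which has total mass 1.
  have h : ∀ t : ℝ, (gammaPDF 1 r * ENNReal.ofReal) t =
      (ENNReal.ofReal r)⁻¹ * gammaPDF 2 r t := fun t => by
    rw [Pi.mul_apply]
    rcases lt_or_ge t 0 with ht | ht
    · rw [gammaPDF_of_neg ht, gammaPDF_of_neg ht, zero_mul, mul_zero]
    · rw [gammaPDF_of_nonneg ht, gammaPDF_of_nonneg ht, ← ENNReal.ofReal_mul' ht,
        ← ENNReal.ofReal_inv_of_pos hr, ← ENNReal.ofReal_mul (by positivity)]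
      congr 1
      rw [Real.Gamma_one, Real.Gamma_two, sub_self, Real.rpow_zero,
        show (2 : ℝ) - 1 = 1 by norm_num, Real.rpow_one, Real.rpow_one, Real.rpow_two]
      field_simp
  simp_rw [h]
  rw [lintegral_const_mul _ (hm 2),
    lintegral_gammaPDF_eq_one two_pos hr, mul_one]

theorem ProbabilityTheory.ae_expMeasure_pos {r : ℝ} (hr : 0 < r) :
    ∀ᵐ t ∂(expMeasure r), 0 < t := by
  have h : {t : ℝ | ¬ 0 < t} = Set.Iic 0 := by ext; simp
  rw [ae_iff, h, expMeasure, gammaMeasure, withDensity_apply _ measurableSet_Iic]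
  refine (lintegral_exponentialPDF_eq_antiDeriv hr 0).trans ?_
  simp

theorem ProbabilityTheory.Kernel.map_zero_trajMeasure {X : ℕ → Type*}
    [∀ n, MeasurableSpace (X n)] (μ₀ : Measure (X 0)) [IsProbabilityMeasure μ₀]
    (κ : (n : ℕ) → Kernel (Π i : Finset.Iic n, X i) (X (n + 1))) [∀ n, IsMarkovKernel (κ n)] :
    (Kernel.trajMeasure μ₀ κ).map (fun ω => ω 0) = μ₀ := by
  have h : (Kernel.trajMeasure μ₀ κ).map (Preorder.frestrictLe 0) =
      μ₀.map (MeasurableEquiv.piUnique fun i : Finset.Iic 0 => X i).symm := by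
    rw [Kernel.trajMeasure, Measure.map_comp _ _ (by fun_prop), Kernel.traj_map_frestrictLe,
      Kernel.partialTraj_self, Measure.id_comp]
    rfl
  have h0 : Measurable fun ω : Π i : Finset.Iic 0, X i => ω ⟨0, Finset.mem_Iic.2 le_rfl⟩ :=
    measurable_pi_apply _
  have h1 : (Kernel.trajMeasure μ₀ κ).map (fun ω => ω 0) =
      ((Kernel.trajMeasure μ₀ κ).map (Preorder.frestrictLe 0)).map
        (fun ω : Π i : Finset.Iic 0, X i => ω ⟨0, Finset.mem_Iic.2 le_rfl⟩) := by
    rw [Measure.map_map h0 (by fun_prop)]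
    rfl
  rw [h1, h]
  refine (Measure.map_map (μ := μ₀)
    (f := (MeasurableEquiv.piUnique fun i : Finset.Iic 0 => X i).symm) h0
    (MeasurableEquiv.measurable _)).trans (Eq.trans ?_ Measure.map_id)
  rfl

/-! ### Return times along a path -/

namespace CTMC

section Paths

variable {S : Type*}

/-- The paths that do not visit `y` in the jumps `1, …, n`. -/
def avoid (y : S) (n : ℕ) : Set (ℕ → S × ℝ) := {ω | ∀ k, 1 ≤ k → k ≤ n → (ω k).1 ≠ y}

theorem avoid_zero (y : S) : avoid y 0 = Set.univ := by
  ext ω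
  simp only [avoid, Set.mem_ofPred_eq, Set.mem_univ, iff_true]
  intro k h1 h2
  omega

theorem mem_avoid_succ {y : S} {n : ℕ} {ω : ℕ → S × ℝ} :
    ω ∈ avoid y (n + 1) ↔ ω ∈ avoid y n ∧ (ω (n + 1)).1 ≠ y := by
  constructor
  · exact fun h => ⟨fun k h1 h2 => h k h1 (by omega), h (n + 1) (by omega) le_rfl⟩
  · rintro ⟨h, h'⟩ k h1 h2
    rcases h2.lt_or_eq with h3 | rfl
    · exact h k h1 (by omega)
    · exact h'

theorem mem_avoid_iff_lt {y : S} {ω : ℕ → S × ℝ} {k : ℕ} (hk : 1 ≤ k) (hy : (ω k).1 = y)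
    (hmin : ∀ j, 1 ≤ j → j < k → (ω j).1 ≠ y) (n : ℕ) : ω ∈ avoid y n ↔ n < k := by
  constructor
  · intro h
    by_contra! hle
    exact h k hk hle hy
  · exact fun h j h1 h2 => hmin j h1 (h2.trans_lt h)

theorem monotone_jumpTime {ω : ℕ → S × ℝ} (hω : ∀ n, 0 < (ω n).2) : Monotone (jumpTime ω) :=
  monotone_nat_of_le_succ fun n => by
    rw [jumpTime, jumpTime, Finset.sum_range_succ]
    linarith [hω n]

/-- Positive holding times make jump times monotone, so the infimum is attained at the first visit
`k ≥ 1`. Holding time `n` counts exactly when `n < k`, that is, when jumps `1, …, n` avoid `y`. -/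
theorem returnTime_eq_tsum {y : S} {ω : ℕ → S × ℝ} (hω : ∀ n, 0 < (ω n).2) {k : ℕ} (hk : 1 ≤ k)
    (hy : (ω k).1 = y) (hmin : ∀ j, 1 ≤ j → j < k → (ω j).1 ≠ y) :
    returnTime y ω =
      ∑' n, (avoid y n).indicator (fun ω : ℕ → S × ℝ => ENNReal.ofReal (ω n).2) ω := by
  have hmono := monotone_jumpTime hω
  have h1 : returnTime y ω = ENNReal.ofReal (jumpTime ω k) := by
    refine le_antisymm ?_ ?_
    · refine iInf₂_le (jumpTime ω k) ⟨hmono hk, k, le_rfl, ?_, hy⟩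
      rw [jumpTime, jumpTime, Finset.sum_range_succ]
      linarith [hω k]
    · refine le_iInf₂ fun t ht => ENNReal.ofReal_le_ofReal ?_
      obtain ⟨ht1, n, hn1, hn2, hny⟩ := ht
      have hn : 1 ≤ n := by
        by_contra! hn
        obtain rfl : n = 0 := by omega
        exact absurd ht1 (not_le.2 hn2)
      exact (hmono (not_lt.1 fun hlt => hmin n hn hlt hny)).trans hn1
  rw [h1, jumpTime, ENNReal.ofReal_sum_of_nonneg fun n _ => (hω n).le,
    tsum_eq_sum (s := Finset.range k) fun n hn => ?_]
  · refine Finset.sum_congr rfl fun n hn => ?_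
    rw [Set.indicator_of_mem ((mem_avoid_iff_lt hk hy hmin n).2 (Finset.mem_range.1 hn))]
  · exact Set.indicator_of_notMem
      (fun h => hn (Finset.mem_range.2 ((mem_avoid_iff_lt hk hy hmin n).1 h))) _

theorem returnTime_eq_top {y : S} {ω : ℕ → S × ℝ} (hy : ∀ k, 1 ≤ k → (ω k).1 ≠ y) :
    returnTime y ω = ∞ := by
  refine iInf₂_eq_top.2 fun t ht => ?_
  obtain ⟨ht1, n, hn1, hn2, hny⟩ := ht
  have hn : 1 ≤ n := by
    by_contra! hn
    obtain rfl : n = 0 := by omega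
    exact absurd ht1 (not_le.2 hn2)
  exact absurd hny (hy n hn)

theorem exists_first_visit {y : S} {ω : ℕ → S × ℝ} (h : ∃ k, 1 ≤ k ∧ (ω k).1 = y) :
    ∃ k, 1 ≤ k ∧ (ω k).1 = y ∧ ∀ j, 1 ≤ j → j < k → (ω j).1 ≠ y := by
  classical
  exact ⟨Nat.find h, (Nat.find_spec h).1, (Nat.find_spec h).2,
    fun j hj hlt hy => Nat.find_min h hlt ⟨hj, hy⟩⟩

theorem returnTime_lt_top_iff {y : S} {ω : ℕ → S × ℝ} (hω : ∀ n, 0 < (ω n).2) :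
    returnTime y ω < ∞ ↔ ω ∉ ⋂ n, avoid y n := by
  constructor
  · intro h hmem
    rw [Set.mem_iInter] at hmem
    exact h.ne (returnTime_eq_top fun k hk => hmem k k hk le_rfl)
  · intro h
    have h' : ∃ k, 1 ≤ k ∧ (ω k).1 = y := by
      by_contra! hc
      exact h (Set.mem_iInter.2 fun n k hk _ => hc k hk)
    obtain ⟨k, hk, hy, hmin⟩ := exists_first_visit h'
    rw [returnTime_eq_tsum hω hk hy hmin, tsum_eq_sum (s := Finset.range k) fun n hn => ?_]
    · refine ENNReal.sum_lt_top.2 fun n _ => ?_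
      exact (Set.indicator_le_self _ _ ω).trans_lt ENNReal.ofReal_lt_top
    · exact Set.indicator_of_notMem
        (fun h => hn (Finset.mem_range.2 ((mem_avoid_iff_lt hk hy hmin n).1 h))) _

end Paths

/-! ### Holding times and the path law -/

section HoldingTimes

variable {S : Type*} (Q : CTMC S)

/-- The expectation of `f` over the holding time in a state. -/
def holdMean (f : S × ℝ → ℝ≥0∞) (x : S) : ℝ≥0∞ :=
  ∫⁻ t, f (x, t) ∂(expMeasure (Q.exitRate x).toReal)

theorem holdMean_snd (x : S) :
    Q.holdMean (fun p => ENNReal.ofReal p.2) x = (Q.exitRate x)⁻¹ := by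
  rw [holdMean]
  dsimp only
  rw [lintegral_ofReal_expMeasure (Q.exitRate_toReal_pos x),
    ENNReal.ofReal_toReal (show Q.exitRate x ≠ ∞ from Q.exit_ne_top x)]

theorem holdMean_nonpos (x : S) :
    Q.holdMean ((Prod.snd ⁻¹' Set.Iic (0 : ℝ)).indicator 1) x = 0 := by
  have h : ∀ t : ℝ, (Prod.snd ⁻¹' Set.Iic (0 : ℝ)).indicator (1 : S × ℝ → ℝ≥0∞) (x, t) =
      (Set.Iic (0 : ℝ)).indicator 1 t := fun t => rfl
  simp_rw [holdMean, h]
  rw [lintegral_indicator_one measurableSet_Iic]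
  have := ae_expMeasure_pos (Q.exitRate_toReal_pos x)
  rw [ae_iff] at this
  simpa [Set.Iic] using this

end HoldingTimes

theorem measurableSet_avoid {S : Type*} [MeasurableSpace S] [MeasurableSingletonClass S] (y : S)
    (n : ℕ) : MeasurableSet (avoid y n) := by
  induction n with
  | zero => rw [avoid_zero]; exact .univ
  | succ n ih =>
    have : avoid y (n + 1) =
        avoid y n ∩ (fun ω : ℕ → S × ℝ => (ω (n + 1)).1) ⁻¹' ({y}ᶜ : Set S) := by
      ext ω; exact mem_avoid_succ
    rw [this]
    exact ih.inter ((measurableSet_singleton y).compl.preimage (by fun_prop))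

variable {S : Type*} [Countable S] [MeasurableSpace S] [MeasurableSingletonClass S] (Q : CTMC S)

instance (x : S) : IsProbabilityMeasure (expMeasure (Q.exitRate x).toReal) :=
  isProbabilityMeasure_expMeasure (Q.exitRate_toReal_pos x)

instance (x : S) : IsProbabilityMeasure (Q.pathLaw x) := by
  unfold pathLaw; infer_instance

theorem lintegral_stepKernel {f : S × ℝ → ℝ≥0∞} (hf : Measurable f) (x : S) :
    ∫⁻ p, f p ∂(Q.stepKernel x) = Q.expect (Q.holdMean f) x := by
  rw [stepKernel, Kernel.lintegral_compProd _ _ _ hf, lintegral_countable']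
  refine tsum_congr fun z => ?_
  rw [mul_comm]
  congr 1
  exact PMF.toMeasure_apply_singleton _ _ (measurableSet_singleton z)

theorem lintegral_pathLaw_zero {f : S × ℝ → ℝ≥0∞} (hf : Measurable f) (x : S) :
    ∫⁻ ω, f (ω 0) ∂(Q.pathLaw x) = Q.holdMean f x := by
  have h : (Q.pathLaw x).map (fun ω => ω 0) =
      (Measure.dirac x).prod (expMeasure (Q.exitRate x).toReal) :=
    Kernel.map_zero_trajMeasure _ _
  rw [← lintegral_map hf (measurable_pi_apply 0), h, lintegral_prod _ hf.aemeasurable,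
    lintegral_dirac' _ hf.lintegral_prod_right']
  rfl

/-- The Markov property, for a product of a functional of the history and a function of the next
step. -/
theorem lintegral_pathLaw_succ {n : ℕ} {g : (Π _ : Finset.Iic n, S × ℝ) → ℝ≥0∞}
    (hg : Measurable g) {f : S × ℝ → ℝ≥0∞} (hf : Measurable f) (x : S) :
    ∫⁻ ω, g (Preorder.frestrictLe n ω) * f (ω (n + 1)) ∂(Q.pathLaw x) =
      ∫⁻ ω, g (Preorder.frestrictLe n ω) * Q.expect (Q.holdMean f) (ω n).1 ∂(Q.pathLaw x) := by
  have hm : Measurable fun ω : ℕ → S × ℝ =>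
      (Preorder.frestrictLe (π := fun _ => S × ℝ) n ω, ω (n + 1)) := by fun_prop
  have hgf : Measurable fun p : (Π _ : Finset.Iic n, S × ℝ) × (S × ℝ) => g p.1 * f p.2 := by
    fun_prop
  have h : (Q.pathLaw x).map (Preorder.frestrictLe n) ⊗ₘ Q.historyKernel n =
      (Q.pathLaw x).map (fun ω => (Preorder.frestrictLe n ω, ω (n + 1))) :=
    Kernel.map_frestrictLe_trajMeasure_compProd_eq_map_trajMeasure
  rw [← lintegral_map (f := fun p => g p.1 * f p.2) hgf hm, ← h, Measure.lintegral_compProd hgf,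
    lintegral_map hgf.lintegral_kernel_prod_right' (by fun_prop)]
  refine lintegral_congr fun ω => ?_
  change ∫⁻ p, g (Preorder.frestrictLe n ω) * f p
    ∂(Q.historyKernel n (Preorder.frestrictLe (π := fun _ => S × ℝ) n ω)) = _
  rw [lintegral_const_mul _ hf]
  congr 1
  exact Q.lintegral_stepKernel hf _

/-- The bridge from paths to operators: conditioning on the history turns the last jump and its
holding time into one application of `T`. -/
theorem lintegral_avoid (y : S) (n : ℕ) {f : S × ℝ → ℝ≥0∞} (hf : Measurable f) (x : S) :
    ∫⁻ ω in avoid y n, f (ω n) ∂(Q.pathLaw x) = (Q.taboo y)^[n] (Q.holdMean f) x := by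
  induction n generalizing f with
  | zero =>
    rw [avoid_zero, Measure.restrict_univ]
    exact Q.lintegral_pathLaw_zero hf x
  | succ n ih =>
    let A : Set (Π _ : Finset.Iic n, S × ℝ) := {h | ∀ k : Finset.Iic n, 1 ≤ k.1 → (h k).1 ≠ y}
    let g : (Π _ : Finset.Iic n, S × ℝ) → ℝ≥0∞ := A.indicator 1
    let f' : S × ℝ → ℝ≥0∞ := (Prod.fst ⁻¹' ({y}ᶜ : Set S)).indicator f
    have hg : Measurable g := by
      refine measurable_one.indicator ?_
      simp only [A, Set.ofPred_forall]
      refine MeasurableSet.iInter fun k => MeasurableSet.iInter fun _ => ?_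
      exact (measurableSet_singleton y).compl.preimage (by fun_prop)
    have hf' : Measurable f' :=
      hf.indicator ((measurableSet_singleton y).compl.preimage measurable_fst)
    have hgω : ∀ ω : ℕ → S × ℝ, g (Preorder.frestrictLe n ω) = (avoid y n).indicator 1 ω :=
      fun ω => by
        have hiff : Preorder.frestrictLe (π := fun _ => S × ℝ) n ω ∈ A ↔ ω ∈ avoid y n :=
          ⟨fun h k h1 h2 => h ⟨k, Finset.mem_Iic.2 h2⟩ h1,
            fun h k h1 => h k h1 (Finset.mem_Iic.1 k.2)⟩
        by_cases hω : ω ∈ avoid y n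
        · rw [Set.indicator_of_mem hω]
          exact Set.indicator_of_mem (hiff.2 hω) _
        · rw [Set.indicator_of_notMem hω]
          exact Set.indicator_of_notMem (fun h => hω (hiff.1 h)) _
    have hmean : Q.expect (Q.holdMean f') = Q.taboo y (Q.holdMean f) := by
      rw [taboo]
      congr 1
      funext z
      by_cases hz : z = y <;> simp [holdMean, f', hz]
    have key := Q.lintegral_pathLaw_succ hg hf' x
    simp only [hgω, hmean] at key
    rw [Function.iterate_succ_apply]
    -- The induction hypothesis is used for a function of the state alone, which averaging over
    -- holding times leaves unchanged.
    have ih' := ih (f := fun p => Q.taboo y (Q.holdMean f) p.1)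
      ((measurable_of_countable _).comp measurable_fst)
    have hhold : Q.holdMean (fun p => Q.taboo y (Q.holdMean f) p.1) =
        Q.taboo y (Q.holdMean f) := by
      funext z
      simp [holdMean]
    rw [hhold] at ih'
    rw [← ih', ← lintegral_indicator (measurableSet_avoid _ _),
      ← lintegral_indicator (measurableSet_avoid _ _)]
    refine Eq.trans (lintegral_congr fun ω => ?_) (key.trans (lintegral_congr fun ω => ?_))
    · by_cases h1 : ω ∈ avoid y n <;> by_cases h2 : (ω (n + 1)).1 = y <;>
        simp [mem_avoid_succ, h1, h2, f']
    · by_cases h1 : ω ∈ avoid y n <;> simp [h1]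

theorem pathLaw_avoid (y : S) (n : ℕ) (x : S) : Q.pathLaw x (avoid y n) = Q.avoidProb y n x := by
  have h := Q.lintegral_avoid y n (f := fun _ => 1) measurable_const x
  rw [setLIntegral_one] at h
  have h1 : Q.holdMean (fun _ => 1) = 1 := by
    funext z
    simp [holdMean]
  rw [h, avoidProb, h1]

theorem ae_holdingTime_pos (x : S) : ∀ᵐ ω ∂(Q.pathLaw x), ∀ n, 0 < (ω n).2 := by
  rw [ae_all_iff]
  intro n
  have hs : MeasurableSet (Prod.snd ⁻¹' Set.Iic (0 : ℝ) : Set (S × ℝ)) :=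
    measurableSet_Iic.preimage measurable_snd
  have hf : Measurable ((Prod.snd ⁻¹' Set.Iic (0 : ℝ)).indicator (1 : S × ℝ → ℝ≥0∞)) :=
    measurable_one.indicator hs
  have h0 : ∫⁻ ω, (Prod.snd ⁻¹' Set.Iic (0 : ℝ)).indicator (1 : S × ℝ → ℝ≥0∞) (ω n)
      ∂(Q.pathLaw x) = 0 := by
    rcases n with _ | n
    · rw [Q.lintegral_pathLaw_zero hf, holdMean_nonpos]
    · have h := Q.lintegral_pathLaw_succ (n := n) (g := fun _ => 1) measurable_const hf x
      simp only [one_mul] at h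
      rw [h]
      simp [funext Q.holdMean_nonpos, expect]
  rw [ae_iff]
  have h1 : {ω : ℕ → S × ℝ | ¬ 0 < (ω n).2} = (fun ω => ω n) ⁻¹' (Prod.snd ⁻¹' Set.Iic 0) := by
    ext; simp
  have h2 : MeasurableSet ((fun ω : ℕ → S × ℝ => ω n) ⁻¹' (Prod.snd ⁻¹' Set.Iic 0)) :=
    hs.preimage (measurable_pi_apply n)
  rw [h1, ← lintegral_indicator_one h2]
  exact h0

theorem recurrentState_iff (y : S) : Q.RecurrentState y ↔ Q.returnProb y y = 1 := by
  have h1 : Q.RecurrentState y ↔ ∀ᵐ ω ∂(Q.pathLaw y), ω ∉ ⋂ n, avoid y n := by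
    refine Filter.eventually_congr ?_
    filter_upwards [Q.ae_holdingTime_pos y] with ω hω
    exact returnTime_lt_top_iff hω
  have h2 : Antitone fun n => (avoid y n : Set (ℕ → S × ℝ)) :=
    antitone_nat_of_succ_le fun n ω h => (mem_avoid_succ.1 h).1
  rw [h1, returnProb_eq_one_iff, ← measure_eq_zero_iff_ae_notMem,
    h2.measure_iInter (fun n => (measurableSet_avoid y n).nullMeasurableSet)
      ⟨0, measure_ne_top _ _⟩]
  simp only [pathLaw_avoid]

/-- Integrate the excursion sum term by term; the mean holding time in `z` is the inverse exit rate.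
-/
theorem lintegral_returnTime {y : S} (hy : Q.RecurrentState y) :
    ∫⁻ ω, returnTime y ω ∂(Q.pathLaw y) =
      ∑' n, (Q.taboo y)^[n] (fun z => (Q.exitRate z)⁻¹) y := by
  have h : ∀ᵐ ω ∂(Q.pathLaw y), returnTime y ω =
      ∑' n, (avoid y n).indicator (fun ω : ℕ → S × ℝ => ENNReal.ofReal (ω n).2) ω := by
    filter_upwards [Q.ae_holdingTime_pos y, hy] with ω hω hr
    have h' : ∃ k, 1 ≤ k ∧ (ω k).1 = y := by
      by_contra! hc
      exact hr.ne (returnTime_eq_top hc)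
    obtain ⟨k, hk, hky, hmin⟩ := exists_first_visit h'
    exact returnTime_eq_tsum hω hk hky hmin
  have hm : Measurable fun p : S × ℝ => ENNReal.ofReal p.2 := measurable_snd.ennreal_ofReal
  have hmean : Q.holdMean (fun p => ENNReal.ofReal p.2) = fun z => (Q.exitRate z)⁻¹ :=
    funext Q.holdMean_snd
  rw [lintegral_congr_ae h, lintegral_tsum fun n => ?_]
  · refine tsum_congr fun n => ?_
    rw [lintegral_indicator (measurableSet_avoid y n), Q.lintegral_avoid y n hm, hmean]
  · exact ((hm.comp (measurable_pi_apply n)).indicator (measurableSet_avoid y n)).aemeasurable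

end CTMC

/-! ### Rates, and comparison of jump counts with elapsed time -/

namespace CTMC

section Rates

variable {S : Type*} (Q : CTMC S)

theorem expect_eq (f : S → ℝ≥0∞) (x : S) :
    Q.expect f x = (∑' z, Q.rate x z * f z) * (Q.exitRate x)⁻¹ := by
  rw [expect, ← ENNReal.tsum_mul_right]
  refine tsum_congr fun z => ?_
  rw [jumpPMF_apply, mul_right_comm]

theorem exitRate_ne_zero (x : S) : Q.exitRate x ≠ 0 := Q.exit_ne_zero x

theorem exitRate_ne_top (x : S) : Q.exitRate x ≠ ∞ := Q.exit_ne_top x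

theorem exitRate_mul_inv (x : S) : Q.exitRate x * (Q.exitRate x)⁻¹ = 1 :=
  ENNReal.mul_inv_cancel (Q.exitRate_ne_zero x) (Q.exitRate_ne_top x)

theorem expect_add_le_of_rate {V : S → ℝ≥0∞} {x : S} {c B : ℝ≥0∞}
    (h : ∑' z, Q.rate x z * V z + c ≤ Q.exitRate x * V x + B) :
    Q.expect V x + c * (Q.exitRate x)⁻¹ ≤ V x + B * (Q.exitRate x)⁻¹ := by
  have := mul_le_mul_left h (Q.exitRate x)⁻¹
  rwa [add_mul, add_mul, ← expect_eq, mul_right_comm, exitRate_mul_inv, one_mul] at this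

theorem le_expect_of_rate {V : S → ℝ≥0∞} {x : S}
    (h : Q.exitRate x * V x ≤ ∑' z, Q.rate x z * V z) : V x ≤ Q.expect V x := by
  have := mul_le_mul_left h (Q.exitRate x)⁻¹
  rwa [← expect_eq, mul_right_comm, exitRate_mul_inv, one_mul] at this

/-- Each jump takes mean time at least `1/M`. -/
theorem avoidProb_le_mul {M : ℝ≥0∞} (hM : ∀ x, Q.exitRate x ≤ M) (y : S) (n : ℕ) (x : S) :
    Q.avoidProb y n x ≤ M * (Q.taboo y)^[n] (fun z => (Q.exitRate z)⁻¹) x := by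
  have h : (1 : S → ℝ≥0∞) ≤ fun z => M * (Q.exitRate z)⁻¹ := fun z => by
    rw [Pi.one_apply, ← Q.exitRate_mul_inv z]
    exact mul_le_mul_left (hM z) _
  have := Q.iterate_taboo_mono y n h x
  rwa [iterate_taboo_const_mul] at this

end Rates

variable {S : Type*} [Countable S] [MeasurableSpace S] [MeasurableSingletonClass S] (Q : CTMC S)

/-- Bounded rates turn the finite mean time into summable avoidance probabilities. These tend to 0,
which is recurrence. -/
theorem positiveRecurrentState_of_tsum_lt_top {M : ℝ≥0∞} (hM' : M ≠ ∞)
    (hM : ∀ x, Q.exitRate x ≤ M) {y : S}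
    (h : ∑' n, (Q.taboo y)^[n] (fun z => (Q.exitRate z)⁻¹) y < ∞) :
    Q.PositiveRecurrentState y := by
  have h1 : ∑' n, Q.avoidProb y n y ≠ ∞ := by
    refine ne_top_of_le_ne_top (ENNReal.mul_ne_top hM' h.ne) ?_
    rw [← ENNReal.tsum_mul_left]
    exact ENNReal.tsum_le_tsum fun n => Q.avoidProb_le_mul hM y n y
  have h2 : Q.RecurrentState y := by
    rw [recurrentState_iff, returnProb_eq_one_iff]
    exact tendsto_nhds_unique (tendsto_atTop_iInf (Q.antitone_avoidProb y y))
      (ENNReal.tendsto_atTop_zero_of_tsum_ne_top h1)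
  exact ⟨h2, (Q.lintegral_returnTime h2).trans_lt h⟩

theorem lintegral_returnTime_eq_top {M : ℝ≥0∞} (hM' : M ≠ ∞) (hM : ∀ x, Q.exitRate x ≤ M) {y : S}
    (hy : Q.RecurrentState y) (h : ∑' n, Q.avoidProb y n y = ∞) :
    ∫⁻ ω, returnTime y ω ∂(Q.pathLaw y) = ∞ := by
  rw [Q.lintegral_returnTime hy]
  by_contra hne
  refine absurd h (ne_top_of_le_ne_top (ENNReal.mul_ne_top hM' hne) ?_)
  rw [← ENNReal.tsum_mul_left]
  exact ENNReal.tsum_le_tsum fun n => Q.avoidProb_le_mul hM y n y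

theorem recurrentState_of_reachable {y x : S} (hy : Q.RecurrentState y) (h : Q.Reachable y x) :
    Q.RecurrentState x := by
  rw [recurrentState_iff] at hy ⊢
  exact Q.returnProb_eq_one_solidarity hy h

/-- A chain with bounded exit rates that has a subharmonic function with bounded jumps, strictly
subharmonic at `x₀`, is null recurrent or transient. -/
theorem nullRecurrent_or_transient {M : ℝ≥0∞} (hM' : M ≠ ∞) (hM : ∀ x, Q.exitRate x ≤ M)
    {x₀ : S} (hr : ∀ y, Q.Reachable y x₀) {V : S → ℝ≥0∞} {b : ℝ≥0∞} (hb' : b ≠ ∞)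
    (hV : ∀ x, V x ≠ ∞) (hb : ∀ x z, Q.rate x z ≠ 0 → V z ≤ V x + b)
    (h : ∀ x, V x ≤ Q.expect V x) (h₀ : V x₀ < Q.expect V x₀) :
    Q.NullRecurrent x₀ ∨ Q.Transient x₀ := by
  by_cases hx : Q.RecurrentState x₀
  · refine .inl fun y hy => ?_
    have hrec := Q.recurrentState_of_reachable hx hy
    exact ⟨hrec, Q.lintegral_returnTime_eq_top hM' hM hrec
      (Q.tsum_avoidProb_eq_top hb' hV hb h h₀ (hr y))⟩
  · exact .inr fun y _ hrec => hx (Q.recurrentState_of_reachable hrec (hr y))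

end CTMC

/-! ### Weighted user counts and their drift in the network -/

/-- The number of users, where a user at rate `c r` is counted `v r` times. -/
def NetState.weight (v : Fin 2 → ℕ) (s : NetState) : ℕ := ∑ i, ∑ r, s i r * v r

theorem NetState.weight_add_user (v : Fin 2 → ℕ) (s : NetState) (i r : Fin 2) :
    (s + NetState.user i r).weight v = s.weight v + v r := by
  fin_cases i <;> fin_cases r <;>
    simp [NetState.weight, NetState.user, Fin.sum_univ_two] <;> ring

theorem NetState.sub_user_add_user {s : NetState} {i r : Fin 2} (h : s i r ≠ 0) :
    s - NetState.user i r + NetState.user i r = s := by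
  funext j t
  by_cases hj : j = i
  · subst hj
    by_cases ht : t = r
    · subst ht
      simp [NetState.user]
      omega
    · simp [NetState.user, ht]
  · simp [NetState.user, hj]

namespace Network

variable (N : Network) (a : AssociationPolicy)

/-- The rate at which users in cell `k` arrive and associate with base station `i`. -/
def joinRate (s : NetState) (k i : Fin 2) : ℝ≥0∞ := ENNReal.ofReal (N.lam * N.p k) * a s k i

/-- The rate at which users leave that are associated with base station `i` at rate `c r`. -/
def leaveRate (s : NetState) (i r : Fin 2) : ℝ≥0∞ :=
  ENNReal.ofReal (N.mu * (s i r * N.throughput s i r))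

theorem leaveRate_eq_zero {s : NetState} {i r : Fin 2} (h : s i r = 0) :
    N.leaveRate s i r = 0 := by
  simp [leaveRate, h]

theorem tsum_rate_mul (s : NetState) (f : NetState → ℝ≥0∞) :
    ∑' s', (N.chain a).rate s s' * f s' =
      ∑ k, ∑ i, N.joinRate a s k i * f (s + NetState.user i (rateIndex k i)) +
      ∑ i, ∑ r, N.leaveRate s i r * f (s - NetState.user i r) := by
  have h : ∀ s', (N.chain a).rate s s' * f s' =
      ∑ k, ∑ i, (if s' = s + NetState.user i (rateIndex k i) then
        N.joinRate a s k i * f s' else 0) +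
      ∑ i, ∑ r, (if s = s' + NetState.user i r then N.leaveRate s i r * f s' else 0) := fun s' => by
    simp only [chain, arrivalRate, departureRate, add_mul, Finset.sum_mul, ite_mul, zero_mul,
      joinRate, leaveRate]
  simp only [h]
  rw [ENNReal.tsum_add, Summable.tsum_finsetSum fun _ _ => ENNReal.summable,
    Summable.tsum_finsetSum fun _ _ => ENNReal.summable]
  congr 1
  · refine Finset.sum_congr rfl fun k _ => ?_
    rw [Summable.tsum_finsetSum fun _ _ => ENNReal.summable]
    refine Finset.sum_congr rfl fun i _ => ?_
    rw [tsum_eq_single (s + NetState.user i (rateIndex k i)) fun s' hs' => if_neg hs', if_pos rfl]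
  · refine Finset.sum_congr rfl fun i _ => ?_
    rw [Summable.tsum_finsetSum fun _ _ => ENNReal.summable]
    refine Finset.sum_congr rfl fun r _ => ?_
    -- With no such user, the truncated subtraction `s - user` returns `s`, but the leave rate is 0.
    by_cases hs : s i r = 0
    · simp [N.leaveRate_eq_zero hs]
    · rw [tsum_eq_single (s - NetState.user i r) fun s' hs' => if_neg fun h' => hs' ?_,
        if_pos (NetState.sub_user_add_user hs).symm]
      rw [h', add_tsub_cancel_right]

theorem exitRate_chain (s : NetState) : (N.chain a).exitRate s =
    ∑ k, ∑ i, N.joinRate a s k i + ∑ i, ∑ r, N.leaveRate s i r := by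
  have h := N.tsum_rate_mul a s 1
  simp only [Pi.one_apply, mul_one] at h
  exact h

theorem sum_joinRate (s : NetState) : ∑ k, ∑ i, N.joinRate a s k i = ENNReal.ofReal N.lam := by
  have h : ∀ k, ∑ i, N.joinRate a s k i = ENNReal.ofReal (N.lam * N.p k) := fun k => by
    simp only [joinRate]
    rw [← Finset.mul_sum, ← tsum_fintype (L := .unconditional _), PMF.tsum_coe, mul_one]
  simp only [h, Fin.sum_univ_two]
  rw [← ENNReal.ofReal_add (mul_nonneg N.lam_pos.le (N.p_nonneg 0))
    (mul_nonneg N.lam_pos.le (N.p_nonneg 1)), ← mul_add, N.p_sum, mul_one]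

/-- The drift of the weight is weight joining minus weight leaving; both losses are moved across the
equality to avoid subtraction in `ℝ≥0∞`. -/
theorem tsum_rate_mul_weight (v : Fin 2 → ℕ) (s : NetState) :
    ∑' s', (N.chain a).rate s s' * (s'.weight v : ℝ≥0∞) + ∑ i, ∑ r, N.leaveRate s i r * v r =
      (N.chain a).exitRate s * s.weight v + ∑ k, ∑ i, N.joinRate a s k i * v (rateIndex k i) := by
  have h1 : ∀ i r, N.leaveRate s i r * ((s - NetState.user i r).weight v : ℝ≥0∞) +
      N.leaveRate s i r * v r = N.leaveRate s i r * s.weight v := fun i r => by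
    by_cases hs : s i r = 0
    · simp [N.leaveRate_eq_zero hs]
    · conv_rhs => rw [← NetState.sub_user_add_user hs, NetState.weight_add_user]
      rw [Nat.cast_add, mul_add]
      congr 2 <;> rw [NetState.sub_user_add_user hs]
  rw [tsum_rate_mul, add_assoc]
  simp only [← Finset.sum_add_distrib, h1]
  rw [exitRate_chain]
  simp only [NetState.weight_add_user, Nat.cast_add, mul_add, Finset.sum_add_distrib, add_mul,
    Finset.sum_mul]
  ring

theorem c_nonneg (r : Fin 2) : 0 ≤ N.c r := by
  fin_cases r
  · exact N.c_pos.le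
  · exact (N.c_pos.trans N.c_lt).le

theorem throughput_nonneg (s : NetState) (i r : Fin 2) : 0 ≤ N.throughput s i r :=
  mul_nonneg (le_min (Nat.cast_nonneg _) (Nat.cast_nonneg _))
    (div_nonneg (N.c_nonneg r) (Nat.cast_nonneg _))

theorem sum_leaveRate_mul (v : Fin 2 → ℕ) (s : NetState) (i : Fin 2) :
    ∑ r, N.leaveRate s i r * v r = ENNReal.ofReal (N.mu * (min (N.m i : ℝ) (s.load i) *
      ((s i 0 * (N.c 0 * v 0) + s i 1 * (N.c 1 * v 1)) / s.load i))) := by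
  have h : ∀ r, N.leaveRate s i r * v r =
      ENNReal.ofReal (N.mu * (s i r * N.throughput s i r) * v r) := fun r => by
    rw [ENNReal.ofReal_mul' (Nat.cast_nonneg _), ENNReal.ofReal_natCast]
    rfl
  have hn : ∀ r, 0 ≤ N.mu * (s i r * N.throughput s i r) * v r := fun r =>
    mul_nonneg (mul_nonneg N.mu_pos.le
      (mul_nonneg (Nat.cast_nonneg _) (N.throughput_nonneg s i r))) (Nat.cast_nonneg _)
  rw [Fin.sum_univ_two, h, h, ← ENNReal.ofReal_add (hn 0) (hn 1)]
  congr 1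
  simp only [throughput]
  ring

theorem load_eq_add (s : NetState) (i : Fin 2) : (s.load i : ℝ) = s i 0 + s i 1 := by
  simp [NetState.load]

/-- At most `m i` chains are busy, and the mean of `c r * v r` over the users of the station is at
most `C`. -/
theorem sum_leaveRate_mul_le (v : Fin 2 → ℕ) {C : ℝ} (hC : ∀ r, N.c r * v r ≤ C)
    (s : NetState) (i : Fin 2) :
    ∑ r, N.leaveRate s i r * v r ≤ ENNReal.ofReal (N.mu * (N.m i * C)) := by
  rw [sum_leaveRate_mul]
  have hC0 : 0 ≤ C := (mul_nonneg (N.c_nonneg 0) (Nat.cast_nonneg _)).trans (hC 0)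
  refine ENNReal.ofReal_le_ofReal (mul_le_mul_of_nonneg_left ?_ N.mu_pos.le)
  have h0 : (0 : ℝ) ≤ s.load i := Nat.cast_nonneg _
  refine mul_le_mul (min_le_left _ _) ?_ ?_ (Nat.cast_nonneg _)
  · refine div_le_of_le_mul₀ h0 hC0 ?_
    rw [load_eq_add, mul_comm C, add_mul]
    exact add_le_add (mul_le_mul_of_nonneg_left (hC 0) (Nat.cast_nonneg _))
      (mul_le_mul_of_nonneg_left (hC 1) (Nat.cast_nonneg _))
  · refine div_nonneg (add_nonneg ?_ ?_) h0 <;>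
      exact mul_nonneg (Nat.cast_nonneg _) (mul_nonneg (N.c_nonneg _) (Nat.cast_nonneg _))

/-- At least one chain is busy, and the mean rate over the users is at least `c 0`. -/
theorem le_sum_leaveRate (s : NetState) {i : Fin 2} (hs : s.load i ≠ 0) :
    ENNReal.ofReal (N.mu * N.c 0) ≤ ∑ r, N.leaveRate s i r := by
  have h := N.sum_leaveRate_mul 1 s i
  simp only [Pi.one_apply, Nat.cast_one, mul_one] at h
  rw [h]
  refine ENNReal.ofReal_le_ofReal (mul_le_mul_of_nonneg_left ?_ N.mu_pos.le)
  have h1 : (1 : ℝ) ≤ s.load i := by exact_mod_cast Nat.one_le_iff_ne_zero.2 hs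
  have h2 : (1 : ℝ) ≤ N.m i := by exact_mod_cast N.one_le_m i
  refine (one_mul (N.c 0)).symm.trans_le ?_
  refine mul_le_mul (le_min h2 h1) ?_ N.c_pos.le (zero_le_one.trans (le_min h2 h1))
  rw [le_div_iff₀ (by linarith), load_eq_add, mul_comm, add_mul]
  gcongr
  exact N.c_lt.le

theorem exitRate_chain_le (s : NetState) : (N.chain a).exitRate s ≤
    ENNReal.ofReal N.lam + ∑ i, ENNReal.ofReal (N.mu * (N.m i * N.c 1)) := by
  rw [exitRate_chain, sum_joinRate]
  gcongr with i
  have h := N.sum_leaveRate_mul_le 1 (C := N.c 1) (fun r => ?_) s i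
  · simpa using h
  · fin_cases r <;> simp [N.c_lt.le]

/-- Departures alone can empty the network. Hence all states reachable from the empty one
communicate, even if some `p k` is 0. -/
theorem reachable_empty (s : NetState) : (N.chain a).Reachable s NetState.empty := by
  induction h : s.weight 1 using Nat.strong_induction_on generalizing s with
  | _ n ih =>
    by_cases hs : s = NetState.empty
    · rw [hs]; exact .refl
    obtain ⟨i, r, hir⟩ : ∃ i r, s i r ≠ 0 := by
      by_contra! hc
      exact hs (funext₂ hc)
    have hw := NetState.weight_add_user 1 (s - NetState.user i r) i r
    rw [NetState.sub_user_add_user hir, Pi.one_apply] at hw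
    refine Relation.ReflTransGen.head ?_ (ih _ (by omega) (s - NetState.user i r) rfl)
    have hload : (0 : ℝ) < s.load i := by
      rw [load_eq_add]
      have : 0 < s i r := Nat.pos_of_ne_zero hir
      have h' : 0 < s i 0 + s i 1 := by fin_cases r <;> simp_all
      exact_mod_cast h'
    have hc : 0 < N.c r := by
      fin_cases r
      · exact N.c_pos
      · exact N.c_pos.trans N.c_lt
    have hm : (0 : ℝ) < N.m i := by exact_mod_cast N.one_le_m i
    have hpos : 0 < N.leaveRate s i r := by
      have : (0 : ℝ) < s i r := by exact_mod_cast Nat.pos_of_ne_zero hir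
      exact ENNReal.ofReal_pos.2 (mul_pos N.mu_pos (mul_pos this
        (mul_pos (lt_min hm hload) (div_pos hc hload))))
    refine (lt_of_lt_of_le hpos ?_).ne'
    refine le_trans ?_ le_add_self
    refine le_trans ?_ (Finset.single_le_sum (fun _ _ => zero_le) (Finset.mem_univ i))
    refine le_trans ?_ (Finset.single_le_sum (fun _ _ => zero_le) (Finset.mem_univ r))
    rw [if_pos (NetState.sub_user_add_user hir).symm]
    rfl

theorem weight_le_of_rate_ne_zero {v : Fin 2 → ℕ} {b : ℕ} (hv : ∀ r, v r ≤ b) {s s' : NetState}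
    (h : (N.chain a).rate s s' ≠ 0) : s'.weight v ≤ s.weight v + b := by
  contrapose! h
  refine add_eq_zero.2 ⟨?_, ?_⟩
  · refine Finset.sum_eq_zero fun k _ => Finset.sum_eq_zero fun i _ => if_neg ?_
    rintro rfl
    rw [NetState.weight_add_user] at h
    have := hv (rateIndex k i)
    omega
  · refine Finset.sum_eq_zero fun i _ => Finset.sum_eq_zero fun r _ => if_neg ?_
    rintro rfl
    rw [NetState.weight_add_user] at h
    omega

/-- The weight is subharmonic because departures never outweigh arrivals, and strictly so at the
empty state, where nobody can leave. -/
theorem unstable_of_le {a : AssociationPolicy} {v : Fin 2 → ℕ} {C : ℝ}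
    (hC : ∀ r, N.c r * v r ≤ C)
    (h : ∀ s, ENNReal.ofReal (N.mu * C * (N.m 0 + N.m 1)) ≤
      ∑ k, ∑ i, N.joinRate a s k i * v (rateIndex k i)) (hC0 : 0 < C) : N.Unstable a := by
  have hmC : ∀ i, 0 < N.mu * (N.m i * C) := fun i =>
    mul_pos N.mu_pos (mul_pos (by exact_mod_cast N.one_le_m i) hC0)
  have hle : ∀ s, ∑ i, ∑ r, N.leaveRate s i r * v r ≤
      ENNReal.ofReal (N.mu * C * (N.m 0 + N.m 1)) := fun s => by
    refine (Finset.sum_le_sum fun i _ => N.sum_leaveRate_mul_le v hC s i).trans_eq ?_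
    rw [Fin.sum_univ_two, ← ENNReal.ofReal_add (hmC 0).le (hmC 1).le]
    congr 1
    ring
  have hjoin : ∀ s, ∑ k, ∑ i, N.joinRate a s k i * (v (rateIndex k i) : ℝ≥0∞) ≠ ∞ := fun s =>
    ENNReal.sum_ne_top.2 fun k _ => ENNReal.sum_ne_top.2 fun i _ =>
      ENNReal.mul_ne_top (ENNReal.mul_ne_top ENNReal.ofReal_ne_top ((a s k).apply_ne_top i))
        (ENNReal.natCast_ne_top _)
  refine (N.chain a).nullRecurrent_or_transient
    (ENNReal.add_ne_top.2 ⟨ENNReal.ofReal_ne_top, ENNReal.sum_ne_top.2 fun i _ =>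
      ENNReal.ofReal_ne_top⟩) (N.exitRate_chain_le a) (N.reachable_empty a)
    (V := fun s => (s.weight v : ℝ≥0∞)) (b := (max (v 0) (v 1) : ℕ)) (ENNReal.natCast_ne_top _)
    (fun _ => ENNReal.natCast_ne_top _) (fun s s' hs => ?_) (fun s => ?_) ?_
  · have hv : ∀ r, v r ≤ max (v 0) (v 1) := fun r => by
      fin_cases r
      · exact le_max_left _ _
      · exact le_max_right _ _
    exact_mod_cast N.weight_le_of_rate_ne_zero a hv hs
  · refine (N.chain a).le_expect_of_rate
      ((ENNReal.add_le_add_iff_right (hjoin s)).1 ?_)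
    rw [← tsum_rate_mul_weight]
    exact add_le_add_right ((hle s).trans (h s)) _
  · have h0 := N.tsum_rate_mul_weight a v NetState.empty
    have hw : NetState.empty.weight v = 0 := by simp [NetState.weight, NetState.empty]
    have hl : ∀ i r, N.leaveRate NetState.empty i r = 0 := fun i r =>
      N.leaveRate_eq_zero rfl
    simp only [hl, hw, zero_mul, Finset.sum_const_zero, add_zero, Nat.cast_zero, mul_zero,
      zero_add] at h0
    simp only [hw, Nat.cast_zero]
    rw [CTMC.expect_eq, h0]
    refine ENNReal.mul_pos (ne_of_gt (lt_of_lt_of_le ?_ (h NetState.empty)))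
      (ENNReal.inv_ne_zero.2 ((N.chain a).exitRate_ne_top _))
    refine ENNReal.ofReal_pos.2 ?_
    have := add_pos (hmC 0) (hmC 1)
    linarith

/-- Foster's criterion with the number of users, for any association policy. -/
theorem stable_of_lt (h : N.lam < N.mu * N.c 0) : N.Stable a := by
  intro y hy
  have hd : 0 < N.mu * N.c 0 - N.lam := sub_pos.2 h
  have hmu : ENNReal.ofReal (N.mu * N.c 0) =
      ENNReal.ofReal (N.mu * N.c 0 - N.lam) + ENNReal.ofReal N.lam := by
    rw [← ENNReal.ofReal_add hd.le N.lam_pos.le, sub_add_cancel]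
  refine (N.chain a).positiveRecurrentState_of_tsum_lt_top
    (ENNReal.add_ne_top.2 ⟨ENNReal.ofReal_ne_top, ENNReal.sum_ne_top.2 fun i _ =>
      ENNReal.ofReal_ne_top⟩) (N.exitRate_chain_le a) ?_
  have hdrift : ∀ s, ∑' s', (N.chain a).rate s s' * (s'.weight 1 : ℝ≥0∞) +
      ∑ i, ∑ r, N.leaveRate s i r =
      (N.chain a).exitRate s * s.weight 1 + ENNReal.ofReal N.lam := fun s => by
    have := N.tsum_rate_mul_weight a 1 s
    simp only [Pi.one_apply, Nat.cast_one, mul_one] at this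
    rw [this, sum_joinRate]
  have key := (N.chain a).tsum_iterate_taboo_lt_top (x₀ := NetState.empty) (y := y)
    (V := fun s => (s.weight 1 : ℝ≥0∞))
    (w := fun s => ENNReal.ofReal (N.mu * N.c 0 - N.lam) * ((N.chain a).exitRate s)⁻¹)
    -- At the empty state the drift is `λ`; adding the required decrease `μ * c 0 - λ` gives `μ * c
    -- 0`, divided by the exit rate to pass to jumps.
    (B := ENNReal.ofReal (N.mu * N.c 0) * ((N.chain a).exitRate NetState.empty)⁻¹)
    (ENNReal.mul_ne_top ENNReal.ofReal_ne_top
      (ENNReal.inv_ne_top.2 ((N.chain a).exitRate_ne_zero _)))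
    (fun _ => ENNReal.natCast_ne_top _) ?_ (fun s hs => ?_)
    (fun z _ => (N.reachable_empty a z).trans hy) y
  · simp only [CTMC.iterate_taboo_const_mul, ENNReal.tsum_mul_left] at key
    exact ENNReal.lt_top_of_mul_ne_top_right key.ne (ENNReal.ofReal_pos.2 hd).ne'
  · refine (N.chain a).expect_add_le_of_rate ?_
    rw [hmu, add_comm (ENNReal.ofReal (_ - _)) (ENNReal.ofReal N.lam), ← add_assoc, ← hdrift]
    gcongr
    exact le_self_add
  · have hs' : ∃ i, s.load i ≠ 0 := by
      by_contra! hc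
      refine hs (funext₂ fun i r => ?_)
      have := hc i
      rw [NetState.load] at this
      fin_cases r <;> simp [NetState.empty] <;> omega
    obtain ⟨i, hi⟩ := hs'
    have h1 : ENNReal.ofReal (N.mu * N.c 0) ≤ ∑ i, ∑ r, N.leaveRate s i r :=
      (N.le_sum_leaveRate s hi).trans (Finset.single_le_sum
        (f := fun i => ∑ r, N.leaveRate s i r) (fun _ _ => zero_le) (Finset.mem_univ i))
    have h2 := (N.chain a).expect_add_le_of_rate (V := fun s => (s.weight 1 : ℝ≥0∞)) (x := s)
      (c := ENNReal.ofReal (N.mu * N.c 0 - N.lam)) (B := 0) ?_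
    · simpa only [zero_mul, add_zero] using h2
    · refine (ENNReal.add_le_add_iff_right (a := ENNReal.ofReal N.lam) ENNReal.ofReal_ne_top).1 ?_
      rw [add_zero, ← hdrift, add_assoc, ← hmu]
      gcongr

/-- The law `q` of the chosen station does not depend on the cell of the user. The incoming weight
is thus the `q`-average of `λ(p 0 + 2 p 1)` and `λ(p 1 + 2 p 0)`, and `p 0 + p 1 = 1`. -/
theorem le_sum_joinRate_loadPolicy (s : NetState) :
    ENNReal.ofReal (N.lam * (1 + min (N.p 0) (N.p 1))) ≤
      ∑ k, ∑ i, N.joinRate loadPolicy s k i * ((![2, 1] : Fin 2 → ℕ) (rateIndex k i) : ℝ≥0∞) := by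
  let q := PMF.uniformOfFinset s.leastLoaded s.leastLoaded_nonempty
  have hq : q 0 + q 1 = 1 := by
    rw [← Fin.sum_univ_two (f := q), ← tsum_fintype (L := .unconditional _), PMF.tsum_coe]
  have hp : ∀ k, 0 ≤ N.lam * N.p k := fun k => mul_nonneg N.lam_pos.le (N.p_nonneg k)
  have hsum := N.p_sum
  have hmin : ∀ i j, i ≠ j → ENNReal.ofReal (N.lam * (1 + min (N.p 0) (N.p 1))) ≤
      ENNReal.ofReal (N.lam * N.p i) + ENNReal.ofReal (N.lam * N.p j) * 2 := fun i j hij => by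
    rw [show (2 : ℝ≥0∞) = ENNReal.ofReal 2 by simp, ← ENNReal.ofReal_mul (hp j),
      ← ENNReal.ofReal_add (hp i) (mul_nonneg (hp j) zero_le_two)]
    refine ENNReal.ofReal_le_ofReal ?_
    rw [mul_assoc, ← mul_add]
    refine mul_le_mul_of_nonneg_left ?_ N.lam_pos.le
    have h0 := min_le_left (N.p 0) (N.p 1)
    have h1 := min_le_right (N.p 0) (N.p 1)
    fin_cases i <;> fin_cases j <;> simp at hij ⊢ <;> linarith
  have hexp : ∑ k, ∑ i, N.joinRate loadPolicy s k i *
      ((![2, 1] : Fin 2 → ℕ) (rateIndex k i) : ℝ≥0∞) =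
      (ENNReal.ofReal (N.lam * N.p 0) + ENNReal.ofReal (N.lam * N.p 1) * 2) * q 0 +
      (ENNReal.ofReal (N.lam * N.p 1) + ENNReal.ofReal (N.lam * N.p 0) * 2) * q 1 := by
    have hj : ∀ k i, N.joinRate loadPolicy s k i = ENNReal.ofReal (N.lam * N.p k) * q i :=
      fun _ _ => rfl
    simp only [hj, rateIndex, Fin.sum_univ_two]
    generalize q 0 = q₀
    generalize q 1 = q₁
    simp
    ring
  rw [hexp, ← mul_one (ENNReal.ofReal _), ← hq, mul_add]
  gcongr
  · exact hmin 0 1 (by decide)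
  · exact hmin 1 0 (by decide)

end Network

end

theorem mainTheorem7 (N : Network) (hc₁ : N.c 0 = 1) (hc₂ : N.c 1 = 2) :
    (N.lam ≥ 2 * N.mu * (N.m 0 + N.m 1) / (1 + min (N.p 0) (N.p 1)) →
      N.Unstable loadPolicy) ∧
    (N.m 0 = 1 → N.m 1 = 1 → N.lam < N.mu → N.Stable loadPolicy) := by
  refine ⟨fun h => ?_, fun _ _ h => N.stable_of_lt loadPolicy (by rwa [hc₁, mul_one])⟩
  -- These weights make `c r * v r = 2` for both rates, so the departure bound loses nothing when
  -- all chains are busy.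
  refine N.unstable_of_le (v := ![2, 1]) (C := 2) (fun r => ?_) (fun s => ?_) two_pos
  · fin_cases r <;> simp [hc₁, hc₂]
  · refine le_trans (ENNReal.ofReal_le_ofReal ?_) (N.le_sum_joinRate_loadPolicy s)
    have hpos : 0 < 1 + min (N.p 0) (N.p 1) := by
      have := le_min (N.p_nonneg 0) (N.p_nonneg 1)
      linarith
    rw [ge_iff_le, div_le_iff₀ hpos] at h
    rwa [mul_comm N.mu 2]
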